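/- Let $(X,d)$ be a nonempty compact metric space and $T:X\to X$ a continuous map. Let $\mathcal M(X)$, $\mathcal M(X,T)$ and $\mathcal M^e(X,T)$ be the sets of Borel probability measures on $X$, of $T$-invariant ones, and of $T$-ergodic ones; $(X,T)$ is uniquely ergodic if $\mathcal M(X,T)$ has exactly one element. Let $(f_i)_{i\ge1}$ be any sequence in $C(X)$ with $\|f_i\|=1$ such that $\rho(\mu,\nu)=\sum_{i\ge1}2^{-i}\,|\int f_i\,d\mu-\int f_i\,d\nu|$ is a metric for the weak* topology of $\mathcal M(X)$ (such sequences exist). For $x\in X$ let $V_T(x)$ be the set of weak* accumulation points of the empirical measures $\frac1n\sum_{i=0}^{n-1}\delta_{T^ix}$, $n\ge1$; for $\varepsilon>0$ put $G^\mu_\varepsilon=\{x\in X:\inf_{\nu\in V_T(x)}\rho(\mu,\nu)\le\varepsilon\}$ and $$\mathcal M^*_{dense}=\{\mu\in\mathcal M(X,T): G^\mu_\varepsilon\text{ is dense in }X\text{ for every }\varepsilon>0\}.$$ $(X,T)$ is transitive if for all nonempty open $U,V\subset X$ there is $n\ge0$ with $U\cap T^{-n}V\ne\emptyset$, and minimal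 if every forward orbit $\{T^nx:n\ge0\}$ is dense. The measure center $C_T(X)$ is the closure of the union of the supports of all $\mu\in\mathcal M(X,T)$. Let $m(\varepsilon,x,y,n),g(\varepsilon,x,y,n)$ be functions with values in $\{0,1,2,\dots\}$ such that $g(\varepsilon,x,y,n)\le n$ for $n\ge1$. $(X,T)$ has the $m$-$g$-product property if for all $\varepsilon>0$ and $x_1,x_2\in X$ there is $N\ge1$ such that for every $n\ge N$ there are $z\in X$, an integer $0\le p\le m(\varepsilon,x_1,x_2,n)$ and $\Lambda\subset\{0,\dots,n-1\}$ with $\#(\{0,\dots,n-1\}\setminus\Lambda)\le g(\varepsilon,x_1,x_2,n)$, $d(z,x_1)<\varepsilon$ and $d(T^{p+j}z,T^jx_2)<\varepsilon$ for all $j\in\Lambda$. It is $m$-$g$-transitive if it is moreover transitive, and $m$-transitive if this holds with $g\equiv0$. $(X,T)$ has the approximate product property if for all $\varepsilon,\delta_1,\delta_2>0$ there is $N\ge1$ such that for every $n\ge N$ and every sequence $(x_i)_{i\ge1}$ in $X$ there are integers $(h_i)_{i\ge1}$ and $x\in X$ with $h_1=0$ and, for every $i\ge1$, $n\le h_{i+1}-h_i\le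 n(1+\delta_2)$ and $\#\{0\le j\le n-1: d(T^{h_i+j}x,T^jx_i)\ge\varepsilon\}\le\delta_1n$. Theorem. (1) Let $0<\kappa<\frac12$. If $(X,T)$ is not uniquely ergodic and is $m$-$g$-transitive with $\liminf_{n\to\infty}\frac{m(\varepsilon,x,y,n)+g(\varepsilon,x,y,n)}{m(\varepsilon,x,y,n)+n}<\kappa$ for all $\varepsilon>0$ and $x,y\in X$, then $\sharp\mathcal M^*_{dense}>1$. (2) If $(X,T)$ has the $m$-$g$-product property with $\liminf_{n\to\infty}\frac{m(\varepsilon,x,y,n)+g(\varepsilon,x,y,n)}{n}=0$ for all $\varepsilon>0$ and $x,y\in X$, then $\mathcal M^e(X,T)\subset\mathcal M^*_{dense}$; if moreover $(X,T)$ is not uniquely ergodic, then $\sharp\mathcal M^*_{dense}>1$. (3) If $(X,T)$ has the approximate product property and $C_T(X)=X$, then $\mathcal M^*_{dense}=\mathcal M(X,T)$, and there are $m,g$ such that $(X,T)$ is $m$-$g$-transitive and $\lim_{n\to\infty}\frac{m(\varepsilon,x,y,n)+g(\varepsilon,x,y,n)}{n}=0$ for all $\varepsilon>0$ and $x,y\in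 X$. (4) If $(X,T)$ is minimal, then $\mathcal M^e(X,T)\subset\mathcal M^*_{dense}$, and for every $\varepsilon>0$ there is $m(\varepsilon)\in\{0,1,2,\dots\}$ such that for all $x_1,x_2\in X$, all $n\ge1$ and all $\varepsilon'>0$ there are $0\le l\le m(\varepsilon)$ and $z\in X$ with $d(z,x_1)<\varepsilon$ and $d(T^{l+j}z,T^jx_2)<\varepsilon'$ for all $0\le j\le n-1$. In particular $(X,T)$ is $m$-transitive with this $m=m(\varepsilon)$, and $\lim_{n\to\infty}\frac{m(\varepsilon)}n=0$ for every $\varepsilon>0$. -/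

import Mathlib

open Filter Topology MeasureTheory

noncomputable section

/-! Throughout, a dynamical system is a continuous self-map `T` of a compact metric space `X`. -/

/-- The space `M(X,T)` of `T`-invariant Borel probability measures. -/
def invMeasures {X : Type*} [MeasurableSpace X] (T : X → X) : Set (ProbabilityMeasure X) :=
  {μ | MeasurePreserving T (μ : Measure X) (μ : Measure X)}

/-- The set of `T`-ergodic (invariant) Borel probability measures. -/
def ergMeasures {X : Type*} [MeasurableSpace X] (T : X → X) : Set (ProbabilityMeasure X) :=
  {μ | Ergodic T (μ : Measure X)}

/-- Unique ergodicity: there is exactly one invariant probability measure. -/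
def UniquelyErgodic {X : Type*} [MeasurableSpace X] (T : X → X) : Prop :=
  ∃! μ : ProbabilityMeasure X, μ ∈ invMeasures T

/-- The `n`-th empirical measure `(1/(n+1)) ∑_{i=0}^{n} δ_{T^i x}` (so that the
average over an orbit segment of length `N ≥ 1` is the one with index `N - 1`). -/
def empirical {X : Type*} [MeasurableSpace X] (T : X → X) (x : X) (n : ℕ) :
    ProbabilityMeasure X :=
  ⟨((n + 1 : ℕ) : ENNReal)⁻¹ • ∑ i ∈ Finset.range (n + 1), Measure.dirac (T^[i] x), ⟨by
    rw [Measure.smul_apply, Measure.finsetSum_apply]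
    simp only [measure_univ, Finset.sum_const, Finset.card_range, nsmul_eq_mul, mul_one,
      smul_eq_mul]
    exact ENNReal.inv_mul_cancel (by simp) (ENNReal.natCast_ne_top _)⟩⟩

/-- `V_T(x)`: the set of weak* accumulation points of the sequence of empirical measures of `x`. -/
def limitMeasures {X : Type*} [TopologicalSpace X] [MeasurableSpace X] [OpensMeasurableSpace X]
    (T : X → X) (x : X) : Set (ProbabilityMeasure X) :=
  {μ | MapClusterPt μ atTop (empirical T x)}

/-- `ρ(μ,ν) = ∑_{i ≥ 1} 2^{-i} |∫ f_i dμ - ∫ f_i dν|`, with the index shifted to start at `0`. -/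
def weakDist {X : Type*} [TopologicalSpace X] [MeasurableSpace X] (f : ℕ → C(X, ℝ))
    (μ ν : ProbabilityMeasure X) : ℝ :=
  ∑' i, |(∫ x, f i x ∂(μ : Measure X)) - ∫ x, f i x ∂(ν : Measure X)| / 2 ^ (i + 1)

/-- The sequence `f` consists of functions of norm one and `weakDist f` is a metric for the
weak* topology of the space of probability measures: its balls form neighbourhood bases.
(The remaining axioms of a metric hold automatically.) -/
def MetrizesWeakStar {X : Type*} [TopologicalSpace X] [CompactSpace X] [MeasurableSpace X]
    [OpensMeasurableSpace X] (f : ℕ → C(X, ℝ)) : Prop :=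
  (∀ i, ‖f i‖ = 1) ∧
    ∀ μ : ProbabilityMeasure X,
      (𝓝 μ).HasBasis (fun ε : ℝ => 0 < ε) (fun ε => {ν | weakDist f μ ν < ε})

/-- `G^μ_ε = {x | ρ(μ, V_T(x)) ≤ ε}`, where `ρ(μ, V) = inf_{ν ∈ V} ρ(μ, ν)`. -/
def nearSaturated {X : Type*} [TopologicalSpace X] [MeasurableSpace X] [OpensMeasurableSpace X]
    (T : X → X) (f : ℕ → C(X, ℝ)) (μ : ProbabilityMeasure X) (ε : ℝ) : Set X :=
  {x | sInf (weakDist f μ '' limitMeasures T x) ≤ ε}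

/-- `M*_dense`: the invariant measures `μ` such that `G^μ_ε` is dense for every `ε > 0`. -/
def denseMeasures {X : Type*} [TopologicalSpace X] [MeasurableSpace X] [OpensMeasurableSpace X]
    (T : X → X) (f : ℕ → C(X, ℝ)) : Set (ProbabilityMeasure X) :=
  {μ | μ ∈ invMeasures T ∧ ∀ ε : ℝ, 0 < ε → Dense (nearSaturated T f μ ε)}

/-- Topological transitivity of `T`. -/
def TopTransitive {X : Type*} [TopologicalSpace X] (T : X → X) : Prop :=
  ∀ U V : Set X, IsOpen U → IsOpen V → U.Nonempty → V.Nonempty →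
    ∃ n : ℕ, (U ∩ T^[n] ⁻¹' V).Nonempty

/-- Minimality of `T`: every forward orbit is dense. -/
def MinimalSystem {X : Type*} [TopologicalSpace X] (T : X → X) : Prop :=
  ∀ x : X, Dense (Set.range fun n : ℕ => T^[n] x)

/-- The measure center `C_T(X)`: the closure of the union of the supports of all invariant
probability measures. -/
def measureCenter {X : Type*} [TopologicalSpace X] [MeasurableSpace X] (T : X → X) : Set X :=
  closure (⋃ μ ∈ invMeasures T, (μ : Measure X).support)

/-- The `m`-`g`-product property, for integer functions `m(ε,x,y,n)` and `g(ε,x,y,n) ≤ n`. -/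
def MGProduct {X : Type*} [MetricSpace X] (T : X → X) (m g : ℝ → X → X → ℕ → ℕ) : Prop :=
  (∀ ε : ℝ, 0 < ε → ∀ x y : X, ∀ n : ℕ, 1 ≤ n → g ε x y n ≤ n) ∧
  ∀ ε : ℝ, 0 < ε → ∀ x₁ x₂ : X, ∃ N : ℕ, 1 ≤ N ∧ ∀ n : ℕ, N ≤ n →
    ∃ (z : X) (p : ℕ) (Λ : Finset ℕ), Λ ⊆ Finset.range n ∧
      p ≤ m ε x₁ x₂ n ∧ (Finset.range n \ Λ).card ≤ g ε x₁ x₂ n ∧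
      dist z x₁ < ε ∧ ∀ j ∈ Λ, dist (T^[p + j] z) (T^[j] x₂) < ε

/-- `m`-`g`-transitivity: the `m`-`g`-product property together with transitivity. -/
def MGTransitive {X : Type*} [MetricSpace X] (T : X → X) (m g : ℝ → X → X → ℕ → ℕ) : Prop :=
  MGProduct T m g ∧ TopTransitive T

/-- The approximate product property. Sequences are indexed from `0`; since `h 0 = 0` and `h`
increases, the integers `h i` are natural numbers. -/
def ApproxProduct {X : Type*} [MetricSpace X] (T : X → X) : Prop :=
  ∀ ε δ₁ δ₂ : ℝ, 0 < ε → 0 < δ₁ → 0 < δ₂ → ∃ N : ℕ, 1 ≤ N ∧ ∀ n : ℕ, N ≤ n →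
    ∀ y : ℕ → X, ∃ (h : ℕ → ℕ) (x : X), h 0 = 0 ∧
      ∀ i : ℕ, h i + n ≤ h (i + 1) ∧ ((h (i + 1) : ℝ) - h i ≤ n * (1 + δ₂)) ∧
        (((Finset.range n).filter
          fun j => ε ≤ dist (T^[h i + j] x) (T^[j] (y i))).card : ℝ) ≤ δ₁ * n


/-- A sequence as in `MetrizesWeakStar` exists on every nonempty compact metric space. -/
theorem exists_metrizesWeakStar (X : Type*) [MetricSpace X] [CompactSpace X] [Nonempty X]
    [MeasurableSpace X] [BorelSpace X] : ∃ f : ℕ → C(X, ℝ), MetrizesWeakStar f := by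
  classical
  let d : ℕ → C(X, ℝ) := TopologicalSpace.denseSeq C(X, ℝ)
  have hd : DenseRange d := TopologicalSpace.denseRange_denseSeq _
  let f : ℕ → C(X, ℝ) := fun i => if d i = 0 then 1 else ‖d i‖⁻¹ • d i
  have hnorm : ∀ i, ‖f i‖ = 1 := by
    intro i
    by_cases h : d i = 0
    · simp [f, h]
    · simp [f, h, norm_smul]
  have hint : ∀ (φ : C(X, ℝ)) (μ : ProbabilityMeasure X), Integrable φ (μ : Measure X) :=
    fun φ μ => φ.continuous.integrable_of_hasCompactSupport (HasCompactSupport.of_compactSpace _)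
  have hb : ∀ (φ : C(X, ℝ)) (μ : ProbabilityMeasure X),
      |∫ x, φ x ∂(μ : Measure X)| ≤ ‖φ‖ := by
    intro φ μ
    have := norm_integral_le_of_norm_le_const (μ := (μ : Measure X)) (f := φ) (C := ‖φ‖)
      (Eventually.of_forall fun x => φ.norm_coe_le_norm x)
    simpa using this
  have hcont : ∀ φ : C(X, ℝ),
      Continuous fun μ : ProbabilityMeasure X => ∫ x, φ x ∂(μ : Measure X) := fun φ =>
    ProbabilityMeasure.continuous_integral_boundedContinuousFunction
      (BoundedContinuousFunction.mkOfCompact φ)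
  have hterm : ∀ i (μ ν : ProbabilityMeasure X),
      ‖|(∫ x, f i x ∂(μ : Measure X)) - ∫ x, f i x ∂(ν : Measure X)| / 2 ^ (i + 1)‖
        ≤ (1 / 2 : ℝ) ^ i := by
    intro i μ ν
    have h1 := hb (f i) μ
    have h2 := hb (f i) ν
    rw [hnorm] at h1 h2
    have h3 := abs_sub (∫ x, f i x ∂(μ : Measure X)) (∫ x, f i x ∂(ν : Measure X))
    rw [Real.norm_of_nonneg (by positivity), div_le_iff₀ (by positivity), pow_succ, ← mul_assoc,
      ← mul_pow]
    norm_num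
    linarith
  have hgeo : Summable fun i : ℕ => (1 / 2 : ℝ) ^ i := summable_geometric_two
  have hρ : ∀ μ, Continuous (weakDist f μ) := fun μ =>
    continuous_tsum (fun i => ((continuous_const.sub (hcont (f i))).abs).div_const _) hgeo
      (fun i ν => hterm i μ ν)
  have hself : ∀ μ, weakDist f μ μ = 0 := fun μ => by simp [weakDist]
  have hnn : ∀ μ ν, 0 ≤ weakDist f μ ν := fun μ ν => tsum_nonneg fun i => by positivity
  have hsep : ∀ μ ν, weakDist f μ ν = 0 → μ = ν := by
    intro μ ν h
    have hs : Summable fun i =>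
        |(∫ x, f i x ∂(μ : Measure X)) - ∫ x, f i x ∂(ν : Measure X)| / 2 ^ (i + 1) :=
      Summable.of_norm_bounded hgeo fun i => hterm i μ ν
    have h0 := (hs.hasSum_iff.2 h)
    rw [hasSum_zero_iff_of_nonneg (fun i => by positivity)] at h0
    have hf0 : ∀ i, ∫ x, f i x ∂(μ : Measure X) = ∫ x, f i x ∂(ν : Measure X) := by
      intro i
      have := congrFun h0 i
      have h2 : (2 : ℝ) ^ (i + 1) ≠ 0 := by positivity
      simpa [div_eq_zero_iff, sub_eq_zero] using this
    have hd0 : ∀ i, ∫ x, d i x ∂(μ : Measure X) = ∫ x, d i x ∂(ν : Measure X) := by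
      intro i
      by_cases hi : d i = 0
      · simp [hi]
      · have := hf0 i
        simpa [f, hi, integral_const_mul] using this
    let L : ProbabilityMeasure X → C(X, ℝ) → ℝ := fun κ φ => ∫ x, φ x ∂(κ : Measure X)
    have hL : ∀ κ, Continuous (L κ) := by
      intro κ
      have : LipschitzWith 1 (L κ) := by
        refine LipschitzWith.of_dist_le_mul fun φ ψ => ?_
        have := hb (φ - ψ) κ
        simp only [ContinuousMap.sub_apply] at this
        rw [integral_sub (hint φ κ) (hint ψ κ)] at this
        simpa [L, Real.dist_eq, dist_eq_norm] using this
      exact this.continuous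
    have hall : L μ = L ν := hd.equalizer (hL μ) (hL ν) (funext hd0)
    have hm : (μ : Measure X) = (ν : Measure X) :=
      ext_of_forall_integral_eq_of_IsFiniteMeasure fun φ => congrFun hall φ.toContinuousMap
    exact Subtype.ext hm
  refine ⟨f, hnorm, fun μ => ⟨fun U => ⟨fun hU => ?_, ?_⟩⟩⟩
  · obtain ⟨V, hVU, hVo, hμV⟩ := mem_nhds_iff.1 hU
    rcases (Vᶜ).eq_empty_or_nonempty with hE | hE
    · refine ⟨1, one_pos, fun ν _ => hVU ?_⟩
      rw [Set.compl_empty_iff.1 hE]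
      trivial
    · obtain ⟨κ, hκ, hmin⟩ :=
        hVo.isClosed_compl.isCompact.exists_isMinOn hE (hρ μ).continuousOn
      refine ⟨weakDist f μ κ, ?_, fun ν hν => hVU ?_⟩
      · refine lt_of_le_of_ne (hnn _ _) fun h => hκ ?_
        rwa [← hsep μ κ h.symm]
      · by_contra hc
        have hle : weakDist f μ κ ≤ weakDist f μ ν := hmin hc
        exact absurd hν (not_lt.2 hle)
  · rintro ⟨ε, hε, hsub⟩
    refine mem_of_superset ((isOpen_lt (hρ μ) continuous_const).mem_nhds ?_) hsub
    simpa [hself] using hε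

end

set_option linter.unusedSectionVars false

/-! ### Weak* convergence, empirical measures and limit measures. -/

section

variable {X : Type*} [MetricSpace X] [CompactSpace X] [MeasurableSpace X] [BorelSpace X]
  {T : X → X} {μ ν : ProbabilityMeasure X}

/-! Limit measures are invariant and constant along orbits (`limitMeasures_apply`), so every limit
measure of a point with dense orbit lies in `denseMeasures`. Birkhoff's theorem gives each ergodic
measure a generic point; lexicographic maximization produces two ergodic measures when unique
ergodicity fails.

Under the product property, a point near any `x` shadows a generic point `y` after a delay `p`, and
their averages differ by at most the oscillation of the test function times `(p + errors)/(p + n)`,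
up to a small term. If this ratio tends to `0` along a sequence, Baire's theorem makes the ergodic
measure a limit measure of residually many points. If it is only below `κ < 1/2`, a function into
`[0,1]` with integrals near `0` and near `1` for two ergodic measures has averages frequently below
and frequently above `1/2` at a residual set of points. One of these has dense orbit, and two of its
limit measures differ (`MGTransitive.one_lt_encard`).

Under the approximate product property, sampling blocks independently from an arbitrary invariant
`μ` replaces a generic point. Full measure center supplies an invariant measure charging a given
open set, hence an initial block whose shadowing orbit must visit that set
(`ApproxProduct.exists_visit`).

In a minimal system a generic point already has dense orbit. Surjectivity and uniform recurrence
give exact rather than approximate tracing (`MinimalSystem.exists_iterate_eq`). -/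

theorem ContinuousMap.integrable_probabilityMeasure (φ : C(X, ℝ)) (μ : ProbabilityMeasure X) :
    Integrable φ (μ : Measure X) :=
  φ.continuous.integrable_of_hasCompactSupport (HasCompactSupport.of_compactSpace _)

theorem continuous_integral_probabilityMeasure (φ : C(X, ℝ)) :
    Continuous fun μ : ProbabilityMeasure X => ∫ x, φ x ∂(μ : Measure X) :=
  ProbabilityMeasure.continuous_integral_continuousMap φ

theorem tendsto_probabilityMeasure_iff {ι : Type*} {F : Filter ι} {u : ι → ProbabilityMeasure X} :
    Tendsto u F (𝓝 μ) ↔ ∀ φ : C(X, ℝ), Tendsto (fun i => ∫ x, φ x ∂(u i : Measure X)) F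
      (𝓝 (∫ x, φ x ∂(μ : Measure X))) :=
  ⟨fun h φ => ((continuous_integral_probabilityMeasure φ).tendsto μ).comp h, fun h =>
    ProbabilityMeasure.tendsto_iff_forall_integral_tendsto.2 fun φ => h φ.toContinuousMap⟩

theorem probabilityMeasure_ext_integral
    (h : ∀ φ : C(X, ℝ), ∫ x, φ x ∂(μ : Measure X) = ∫ x, φ x ∂(ν : Measure X)) : μ = ν :=
  Subtype.ext (ext_of_forall_integral_eq_of_IsFiniteMeasure (μ := (μ : Measure X))
    (ν := (ν : Measure X)) fun φ => h φ.toContinuousMap)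

theorem integral_empirical (T : X → X) (x : X) (n : ℕ) (φ : C(X, ℝ)) :
    ∫ y, φ y ∂(empirical T x n : Measure X) = birkhoffAverage ℝ T φ (n + 1) x := by
  have : ((empirical T x n : ProbabilityMeasure X) : Measure X) =
    ((n + 1 : ℕ) : ENNReal)⁻¹ • ∑ i ∈ Finset.range (n + 1), Measure.dirac (T^[i] x) := rfl
  rw [this, integral_smul_measure, integral_finsetSum_measure]
  · rw [ENNReal.toReal_inv, ENNReal.toReal_natCast]
    simp only [birkhoffAverage, birkhoffSum, integral_dirac]
  · intro i _
    exact φ.integrable_probabilityMeasure ⟨Measure.dirac (T^[i] x), inferInstance⟩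

theorem continuous_birkhoffAverage (hT : Continuous T) (φ : C(X, ℝ)) (n : ℕ) :
    Continuous fun x => birkhoffAverage ℝ T φ n x := by
  simp only [birkhoffAverage, birkhoffSum, smul_eq_mul]
  exact continuous_const.mul (continuous_finsetSum _ fun i _ => φ.continuous.comp (hT.iterate i))

theorem continuous_empirical (hT : Continuous T) (n : ℕ) :
    Continuous fun x => empirical T x n := by
  refine continuous_iff_continuousAt.2 fun x => tendsto_probabilityMeasure_iff.2 fun φ => ?_
  simp only [integral_empirical]
  exact (continuous_birkhoffAverage hT φ (n + 1)).tendsto x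

theorem mem_invMeasures_iff (hT : Continuous T) :
    μ ∈ invMeasures T ↔
      ∀ φ : C(X, ℝ), ∫ x, φ (T x) ∂(μ : Measure X) = ∫ x, φ x ∂(μ : Measure X) := by
  have hmap : ∀ φ : C(X, ℝ), ∫ x, φ x ∂(Measure.map T (μ : Measure X)) =
      ∫ x, φ (T x) ∂(μ : Measure X) := fun φ =>
    integral_map hT.aemeasurable φ.continuous.aestronglyMeasurable
  constructor
  · intro h φ
    rw [← hmap, MeasurePreserving.map_eq h]
  · intro h
    refine ⟨hT.measurable, ?_⟩
    have : IsProbabilityMeasure (Measure.map T (μ : Measure X)) :=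
      Measure.isProbabilityMeasure_map hT.aemeasurable
    refine ext_of_forall_integral_eq_of_IsFiniteMeasure fun φ => ?_
    exact (hmap φ.toContinuousMap).trans (h φ.toContinuousMap)

theorem isClosed_invMeasures (hT : Continuous T) :
    IsClosed (invMeasures T : Set (ProbabilityMeasure X)) := by
  have : (invMeasures T : Set (ProbabilityMeasure X)) = ⋂ φ : C(X, ℝ),
      {μ : ProbabilityMeasure X | ∫ x, φ (T x) ∂(μ : Measure X) = ∫ x, φ x ∂(μ : Measure X)} := by
    ext μ
    simp [mem_invMeasures_iff hT]
  rw [this]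
  exact isClosed_iInter fun φ => isClosed_eq
    (continuous_integral_probabilityMeasure (φ.comp ⟨T, hT⟩))
    (continuous_integral_probabilityMeasure φ)

theorem tendsto_birkhoffAverage_apply_sub (φ : C(X, ℝ)) (x : X) :
    Tendsto (fun n : ℕ => birkhoffAverage ℝ T φ (n + 1) (T x) - birkhoffAverage ℝ T φ (n + 1) x)
      atTop (𝓝 0) := by
  have h : Tendsto (fun n : ℕ => (2 * ‖φ‖) / ((n : ℝ) + 1)) atTop (𝓝 0) :=
    tendsto_const_nhds.div_atTop (tendsto_atTop_add_const_right _ _ tendsto_natCast_atTop_atTop)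
  refine squeeze_zero_norm (fun n => ?_) h
  rw [birkhoffAverage_apply_sub_birkhoffAverage, norm_smul, norm_inv, div_eq_inv_mul]
  have h1 := φ.norm_coe_le_norm (T^[n + 1] x)
  have h2 := φ.norm_coe_le_norm x
  have h3 := norm_sub_le (φ (T^[n + 1] x)) (φ x)
  have h4 : ‖((n + 1 : ℕ) : ℝ)‖ = (n : ℝ) + 1 := by
    rw [Real.norm_natCast]; push_cast; rfl
  rw [h4]
  gcongr
  linarith

/-- An ultrafilter turns a cluster point into a genuine limit for all test functions at once, so
limits can be added and subtracted. -/
theorem mem_limitMeasures_iff_ultrafilter {x : X} : μ ∈ limitMeasures T x ↔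
    ∃ U : Ultrafilter ℕ, (U : Filter ℕ) ≤ atTop ∧ ∀ φ : C(X, ℝ),
      Tendsto (fun n => birkhoffAverage ℝ T φ (n + 1) x) U (𝓝 (∫ x, φ x ∂(μ : Measure X))) := by
  simp only [limitMeasures, Set.mem_ofPred_eq, mapClusterPt_iff_ultrafilter,
    tendsto_probabilityMeasure_iff, integral_empirical]

theorem limitMeasures_apply (T : X → X) (x : X) : limitMeasures T (T x) = limitMeasures T x := by
  ext μ
  simp only [mem_limitMeasures_iff_ultrafilter]
  refine exists_congr fun U => and_congr_right fun hU => forall_congr' fun φ => ?_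
  have h0 := (tendsto_birkhoffAverage_apply_sub (T := T) φ x).mono_left hU
  constructor <;> intro h
  · simpa using h.sub h0
  · simpa using h.add h0

theorem limitMeasures_iterate (T : X → X) (x : X) (k : ℕ) :
    limitMeasures T (T^[k] x) = limitMeasures T x := by
  induction k with
  | zero => rfl
  | succ k ih => rw [Function.iterate_succ_apply', limitMeasures_apply, ih]

theorem limitMeasures_subset_invMeasures (hT : Continuous T) (x : X) :
    limitMeasures T x ⊆ invMeasures T := by
  intro μ hμ
  rw [mem_invMeasures_iff hT]
  obtain ⟨U, hU, h⟩ := mem_limitMeasures_iff_ultrafilter.1 hμ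
  intro φ
  have h1 := h (φ.comp ⟨T, hT⟩)
  have h2 := (h φ).add ((tendsto_birkhoffAverage_apply_sub (T := T) φ x).mono_left hU)
  rw [add_zero] at h2
  refine tendsto_nhds_unique h1 (h2.congr fun n => ?_)
  rw [add_sub_cancel]
  simp only [birkhoffAverage, birkhoffSum, ContinuousMap.coe_comp, ContinuousMap.coe_mk,
    Function.comp_apply]
  simp only [← Function.iterate_succ_apply', Function.iterate_succ_apply]

theorem exists_mem_limitMeasures_of_frequently {S : Set (ProbabilityMeasure X)} (hS : IsClosed S)
    {x : X} (h : ∃ᶠ n in atTop, empirical T x n ∈ S) : ∃ ν ∈ limitMeasures T x, ν ∈ S := by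
  have hc : IsCompact S := hS.isCompact
  obtain ⟨ν, hν, hcl⟩ := hc.exists_mapClusterPt_of_frequently h
  exact ⟨ν, hcl, hν⟩

theorem limitMeasures_nonempty (T : X → X) (x : X) : (limitMeasures T x).Nonempty := by
  obtain ⟨ν, hν, -⟩ := exists_mem_limitMeasures_of_frequently (T := T) (x := x) isClosed_univ
    (Frequently.of_forall fun _ => Set.mem_univ _)
  exact ⟨ν, hν⟩

theorem invMeasures_nonempty [Nonempty X] (hT : Continuous T) :
    (invMeasures T : Set (ProbabilityMeasure X)).Nonempty :=
  (limitMeasures_nonempty T (Classical.arbitrary X)).mono (limitMeasures_subset_invMeasures hT _)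

theorem weakDist_nonneg (f : ℕ → C(X, ℝ)) (μ ν : ProbabilityMeasure X) : 0 ≤ weakDist f μ ν :=
  tsum_nonneg fun _ => by positivity

theorem weakDist_self (f : ℕ → C(X, ℝ)) (μ : ProbabilityMeasure X) : weakDist f μ μ = 0 := by
  simp [weakDist]

theorem mem_nearSaturated {f : ℕ → C(X, ℝ)} {x : X} {ε : ℝ} (hν : ν ∈ limitMeasures T x)
    (h : weakDist f μ ν ≤ ε) : x ∈ nearSaturated T f μ ε := by
  have hb : BddBelow (weakDist f μ '' limitMeasures T x) := by
    refine ⟨0, ?_⟩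
    rintro _ ⟨κ, -, rfl⟩
    exact weakDist_nonneg f μ κ
  exact (csInf_le hb ⟨ν, hν, rfl⟩).trans h

theorem mem_nearSaturated_of_mem {f : ℕ → C(X, ℝ)} {x : X} {ε : ℝ} (hε : 0 < ε)
    (hμ : μ ∈ limitMeasures T x) : x ∈ nearSaturated T f μ ε :=
  mem_nearSaturated hμ ((weakDist_self f μ).trans_le hε.le)

/-- If `μ` is a limit measure for a dense set of points, then `μ` lies in `M*_dense`. -/
theorem mem_denseMeasures_of_dense [Nonempty X] (hT : Continuous T) {f : ℕ → C(X, ℝ)}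
    (h : Dense {x | μ ∈ limitMeasures T x}) : μ ∈ denseMeasures T f := by
  obtain ⟨x, hx⟩ := h.nonempty
  exact ⟨limitMeasures_subset_invMeasures hT x hx,
    fun ε hε => h.mono fun x hx => mem_nearSaturated_of_mem hε hx⟩

theorem limitMeasures_subset_denseMeasures [Nonempty X] (hT : Continuous T) (f : ℕ → C(X, ℝ))
    {x : X} (hx : Dense (Set.range fun n : ℕ => T^[n] x)) :
    limitMeasures T x ⊆ denseMeasures T f := by
  intro μ hμ
  refine mem_denseMeasures_of_dense hT (hx.mono ?_)
  rintro _ ⟨n, rfl⟩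
  rwa [Set.mem_ofPred_eq, limitMeasures_iterate]

end

/-! ### The maximal ergodic theorem and Birkhoff's theorem. -/

section

variable {Ω : Type*} [MeasurableSpace Ω]

/-- `maxBirkhoffSum T φ N x = max_{0 ≤ k ≤ N} ∑_{i < k} φ (T^i x)`. -/
def maxBirkhoffSum (T : Ω → Ω) (φ : Ω → ℝ) : ℕ → Ω → ℝ
  | 0 => fun _ => 0
  | N + 1 => fun x => max 0 (φ x + maxBirkhoffSum T φ N (T x))

variable {T : Ω → Ω} {φ : Ω → ℝ}

theorem maxBirkhoffSum_nonneg (N : ℕ) (x : Ω) : 0 ≤ maxBirkhoffSum T φ N x := by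
  cases N with
  | zero => exact le_rfl
  | succ N => exact le_max_left _ _

theorem maxBirkhoffSum_le_succ (N : ℕ) (x : Ω) :
    maxBirkhoffSum T φ N x ≤ maxBirkhoffSum T φ (N + 1) x := by
  induction N generalizing x with
  | zero => exact le_max_left _ _
  | succ N ih => exact max_le_max le_rfl (add_le_add le_rfl (ih (T x)))

theorem maxBirkhoffSum_mono (x : Ω) : Monotone fun N => maxBirkhoffSum T φ N x :=
  monotone_nat_of_le_succ fun N => maxBirkhoffSum_le_succ N x

theorem birkhoffSum_le_maxBirkhoffSum (N : ℕ) (x : Ω) :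
    birkhoffSum T φ N x ≤ maxBirkhoffSum T φ N x := by
  induction N generalizing x with
  | zero => simp [birkhoffSum, maxBirkhoffSum]
  | succ N ih =>
    rw [birkhoffSum_succ']
    exact (add_le_add le_rfl (ih (T x))).trans (le_max_right _ _)

theorem measurable_maxBirkhoffSum (hT : Measurable T) (hφ : Measurable φ) (N : ℕ) :
    Measurable (maxBirkhoffSum T φ N) := by
  induction N with
  | zero => exact measurable_const
  | succ N ih => exact measurable_const.max (hφ.add (ih.comp hT))

theorem integrable_maxBirkhoffSum {μ : Measure Ω} (hT : MeasurePreserving T μ μ)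
    (hφ : Integrable φ μ) (N : ℕ) : Integrable (maxBirkhoffSum T φ N) μ := by
  induction N with
  | zero => exact integrable_zero _ _ _
  | succ N ih =>
    have := (hφ.add (hT.integrable_comp_of_integrable ih)).pos_part
    refine this.congr (Eventually.of_forall fun x => ?_)
    simp [maxBirkhoffSum, max_comm]

/-- A form of the maximal ergodic theorem: the Birkhoff sums of a function of negative integral
are almost surely bounded above. -/
theorem Ergodic.ae_exists_birkhoffSum_le {μ : Measure Ω} [IsProbabilityMeasure μ]
    (hT : Ergodic T μ) (hφm : Measurable φ) (hφ : Integrable φ μ) (hneg : ∫ x, φ x ∂μ < 0) :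
    ∀ᵐ x ∂μ, ∃ B : ℝ, ∀ n, birkhoffSum T φ n x ≤ B := by
  let F := maxBirkhoffSum T φ
  have hF : ∀ N, Measurable (F N) := measurable_maxBirkhoffSum hT.measurable hφm
  have hFi : ∀ N, Integrable (F N) μ :=
    integrable_maxBirkhoffSum hT.toMeasurePreserving hφ
  -- `E` is where the maximal sums are unbounded. The recursion for `maxBirkhoffSum` makes it
  -- strictly invariant, hence null or of full measure.
  let E : Set Ω := {x | ∀ k : ℕ, ∃ N, (k : ℝ) < F N x}
  have hEm : MeasurableSet E := by
    have : E = ⋂ k : ℕ, ⋃ N, {x | (k : ℝ) < F N x} := by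
      ext x
      simp [E]
    rw [this]
    exact MeasurableSet.iInter fun k => MeasurableSet.iUnion fun N =>
      measurableSet_lt measurable_const (hF N)
  have hEinv : T ⁻¹' E = E := by
    ext x
    constructor
    · intro h k
      obtain ⟨l, hl⟩ := exists_nat_gt ((k : ℝ) - φ x)
      obtain ⟨N, hN⟩ := h l
      refine ⟨N + 1, lt_of_lt_of_le ?_ (le_max_right _ _)⟩
      change (l : ℝ) < maxBirkhoffSum T φ N (T x) at hN
      linarith
    · intro h k
      obtain ⟨l, hl⟩ := exists_nat_gt ((k : ℝ) + φ x)
      -- The `1` excludes `N = 0` and the branch of the maximum equal to `0`.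
      obtain ⟨N, hN⟩ := h (max l 1)
      have hl1 : (0 : ℝ) < (max l 1 : ℕ) := by exact_mod_cast (lt_max_of_lt_right one_pos)
      have hl2 : (l : ℝ) ≤ (max l 1 : ℕ) := by exact_mod_cast le_max_left _ _
      cases N with
      | zero =>
        change ((max l 1 : ℕ) : ℝ) < 0 at hN
        linarith
      | succ N =>
        refine ⟨N, ?_⟩
        rcases lt_max_iff.1 hN with h0 | h0
        · linarith
        · change _ < φ x + F N (T x) at h0
          linarith
  have hbdd : ∀ x, x ∉ E → ∃ B : ℝ, ∀ n, birkhoffSum T φ n x ≤ B := by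
    intro x hx
    simp only [E, Set.mem_ofPred_eq, not_forall, not_exists, not_lt] at hx
    obtain ⟨k, hk⟩ := hx
    exact ⟨k, fun n => (birkhoffSum_le_maxBirkhoffSum n x).trans (hk n)⟩
  rcases hT.toPreErgodic.ae_mem_or_ae_notMem hEm hEinv with hE | hE
  · exfalso
    -- On `E` the integrand is eventually equal to `φ`, and it is always dominated by `|φ|`.
    -- Invariance and monotonicity in `N` make its integral nonnegative, which contradicts `hneg`.
    have hlim : Tendsto (fun N => ∫ x, (F (N + 1) x - F N (T x)) ∂μ) atTop
        (𝓝 (∫ x, φ x ∂μ)) := by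
      refine tendsto_integral_of_dominated_convergence (fun x => |φ x|) ?_ hφ.abs ?_ ?_
      · exact fun N => ((hF _).sub ((hF N).comp hT.measurable)).aestronglyMeasurable
      · refine fun N => Eventually.of_forall fun x => ?_
        have h0 : 0 ≤ F N (T x) := maxBirkhoffSum_nonneg N _
        have h1 : F (N + 1) x = max 0 (φ x + F N (T x)) := rfl
        rw [h1, Real.norm_eq_abs]
        rcases max_cases 0 (φ x + F N (T x)) with ⟨h, h'⟩ | ⟨h, h'⟩
        · rw [h]
          exact abs_le_abs_of_nonpos (by linarith) (by linarith)
        · rw [h, add_sub_cancel_right]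
      · filter_upwards [hE] with x hx
        rw [← hEinv] at hx
        obtain ⟨l, hl⟩ := exists_nat_gt (-φ x)
        obtain ⟨N, hN⟩ := hx l
        refine tendsto_const_nhds.congr' ?_
        filter_upwards [eventually_ge_atTop N] with M hM
        have h2 : F N (T x) ≤ F M (T x) := maxBirkhoffSum_mono (T x) hM
        have h1 : F (M + 1) x = max 0 (φ x + F M (T x)) := rfl
        rw [h1, max_eq_right (by linarith)]
        ring
    have hnn : ∀ N, 0 ≤ ∫ x, (F (N + 1) x - F N (T x)) ∂μ := by
      intro N
      rw [integral_sub (g := fun x => F N (T x)) (hFi _)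
        (hT.toMeasurePreserving.integrable_comp_of_integrable (hFi N))]
      have : ∫ x, F N (T x) ∂μ = ∫ x, F N x ∂μ := by
        have h := integral_map (μ := μ) hT.measurable.aemeasurable (f := F N)
          (hF N).aestronglyMeasurable
        rw [hT.toMeasurePreserving.map_eq] at h
        exact h.symm
      rw [this, sub_nonneg]
      exact integral_mono (hFi _) (hFi _) (maxBirkhoffSum_le_succ N)
    exact absurd (ge_of_tendsto' hlim hnn) (not_le.2 hneg)
  · filter_upwards [hE] with x hx using hbdd x hx

/-- For `b` between the integral and `c`, the sums of `φ - b` are bounded by some `B`, so the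
averages of `φ` are at most `b + B / n`. -/
theorem Ergodic.ae_eventually_birkhoffAverage_lt {μ : Measure Ω} [IsProbabilityMeasure μ]
    (hT : Ergodic T μ) (hφm : Measurable φ) (hφ : Integrable φ μ) {c : ℝ}
    (hc : ∫ x, φ x ∂μ < c) :
    ∀ᵐ x ∂μ, ∀ᶠ n : ℕ in atTop, birkhoffAverage ℝ T φ n x < c := by
  obtain ⟨b, hb, hbc⟩ := exists_between hc
  have h := hT.ae_exists_birkhoffSum_le (φ := fun x => φ x - b) (hφm.sub_const b)
    (hφ.sub (integrable_const b)) (by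
      rw [integral_sub hφ (integrable_const b)]
      simpa using hb)
  filter_upwards [h] with x hx
  obtain ⟨B, hB⟩ := hx
  have hlim : Tendsto (fun n : ℕ => B / (n : ℝ)) atTop (𝓝 0) :=
    tendsto_const_nhds.div_atTop tendsto_natCast_atTop_atTop
  filter_upwards [hlim.eventually_lt_const (sub_pos.2 hbc), eventually_gt_atTop 0] with n hn hn0
  have hn0' : (0 : ℝ) < n := by exact_mod_cast hn0
  have h1 : birkhoffSum T φ n x - n * b ≤ B := by
    have := hB n
    simpa [birkhoffSum, Finset.sum_sub_distrib] using this
  rw [birkhoffAverage, smul_eq_mul, ← div_eq_inv_mul, div_lt_iff₀ hn0']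
  rw [div_lt_iff₀ hn0'] at hn
  nlinarith

/-- **Birkhoff's pointwise ergodic theorem** for an ergodic map. -/
theorem Ergodic.ae_tendsto_birkhoffAverage {μ : Measure Ω} [IsProbabilityMeasure μ]
    (hT : Ergodic T μ) (hφm : Measurable φ) (hφ : Integrable φ μ) :
    ∀ᵐ x ∂μ, Tendsto (fun n => birkhoffAverage ℝ T φ n x) atTop (𝓝 (∫ x, φ x ∂μ)) := by
  have h1 : ∀ᵐ x ∂μ, ∀ k : ℕ, ∀ᶠ n : ℕ in atTop,
      birkhoffAverage ℝ T φ n x < ∫ x, φ x ∂μ + 1 / ((k : ℝ) + 1) :=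
    ae_all_iff.2 fun k => hT.ae_eventually_birkhoffAverage_lt hφm hφ
      (lt_add_of_pos_right _ (by positivity))
  have h2 : ∀ᵐ x ∂μ, ∀ k : ℕ, ∀ᶠ n : ℕ in atTop,
      birkhoffAverage ℝ T (-φ) n x < -∫ x, φ x ∂μ + 1 / ((k : ℝ) + 1) :=
    ae_all_iff.2 fun k => hT.ae_eventually_birkhoffAverage_lt hφm.neg hφ.neg (by
      simp only [Pi.neg_apply, integral_neg]
      exact lt_add_of_pos_right _ (by positivity))
  filter_upwards [h1, h2] with x hx1 hx2
  rw [tendsto_order]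
  constructor
  · intro a ha
    obtain ⟨k, hk⟩ := exists_nat_one_div_lt (sub_pos.2 ha)
    filter_upwards [hx2 k] with n hn
    rw [birkhoffAverage_neg, Pi.neg_apply, Pi.neg_apply] at hn
    linarith
  · intro a ha
    obtain ⟨k, hk⟩ := exists_nat_one_div_lt (sub_pos.2 ha)
    filter_upwards [hx1 k] with n hn
    linarith

end

/-! ### Generic points of ergodic measures. -/

section

variable {X : Type*} [MetricSpace X] [CompactSpace X] [MeasurableSpace X] [BorelSpace X]
  {T : X → X}

theorem abs_integral_sub_integral_le (φ ψ : C(X, ℝ)) (μ : ProbabilityMeasure X) :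
    |∫ x, φ x ∂(μ : Measure X) - ∫ x, ψ x ∂(μ : Measure X)| ≤ ‖φ - ψ‖ := by
  rw [← integral_sub (φ.integrable_probabilityMeasure μ) (ψ.integrable_probabilityMeasure μ)]
  have := norm_integral_le_of_norm_le_const (μ := (μ : Measure X)) (f := fun x => φ x - ψ x)
    (C := ‖φ - ψ‖) (Eventually.of_forall fun x => (φ - ψ).norm_coe_le_norm x)
  simpa using this

/-- The functionals are uniformly 1-Lipschitz, so a countable dense family of test functions
suffices. Almost sure statements thereby need only one null set. -/
theorem tendsto_of_denseRange {E ι κ : Type*} [NormedAddCommGroup E] {F : Filter κ} {d : ι → E}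
    (hd : DenseRange d) {L : κ → E → ℝ} {L' : E → ℝ}
    (hL : ∀ n φ ψ, |L n φ - L n ψ| ≤ ‖φ - ψ‖) (hL' : ∀ φ ψ, |L' φ - L' ψ| ≤ ‖φ - ψ‖)
    (h : ∀ i, Tendsto (fun n => L n (d i)) F (𝓝 (L' (d i)))) (φ : E) :
    Tendsto (fun n => L n φ) F (𝓝 (L' φ)) := by
  rw [Metric.tendsto_nhds]
  intro ε hε
  obtain ⟨i, hi⟩ := hd.exists_dist_lt φ (show 0 < ε / 3 by positivity)
  rw [dist_eq_norm] at hi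
  filter_upwards [Metric.tendsto_nhds.1 (h i) (ε / 3) (by positivity)] with n hn
  rw [Real.dist_eq] at hn ⊢
  have h1 := hL n φ (d i)
  have h2 := hL' φ (d i)
  rw [abs_lt] at hn ⊢
  rw [abs_le] at h1 h2
  constructor <;> linarith

/-- Every ergodic measure has a generic point. -/
theorem exists_generic_point (μ : ProbabilityMeasure X) (hμ : μ ∈ ergMeasures T) :
    ∃ x : X, ∀ φ : C(X, ℝ),
      Tendsto (fun n => birkhoffAverage ℝ T φ n x) atTop (𝓝 (∫ x, φ x ∂(μ : Measure X))) := by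
  have : Nonempty X := (μ : Measure X).nonempty_of_neZero
  let d : ℕ → C(X, ℝ) := TopologicalSpace.denseSeq C(X, ℝ)
  have hd : DenseRange d := TopologicalSpace.denseRange_denseSeq _
  have hae : ∀ᵐ x ∂(μ : Measure X), ∀ i, Tendsto (fun n => birkhoffAverage ℝ T (d i) n x) atTop
      (𝓝 (∫ x, d i x ∂(μ : Measure X))) :=
    ae_all_iff.2 fun i => Ergodic.ae_tendsto_birkhoffAverage hμ (d i).continuous.measurable
      ((d i).integrable_probabilityMeasure μ)
  obtain ⟨x, hx⟩ := hae.exists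
  refine ⟨x, fun φ => (tendsto_add_atTop_iff_nat 1).1 ?_⟩
  simp only [← integral_empirical]
  refine tendsto_of_denseRange hd
    (L := fun n φ => ∫ y, φ y ∂(empirical T x n : Measure X))
    (L' := fun φ => ∫ y, φ y ∂(μ : Measure X)) (fun n φ ψ => abs_integral_sub_integral_le φ ψ _)
    (fun φ ψ => abs_integral_sub_integral_le φ ψ _) (fun i => ?_) φ
  simp only [integral_empirical]
  exact (tendsto_add_atTop_iff_nat 1).2 (hx i)

end

/-! ### Ergodic measures by lexicographic maximization, and their separation. -/

section

variable {X : Type*} [MetricSpace X] [CompactSpace X] [MeasurableSpace X] [BorelSpace X]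
  {T : X → X}

/-- The invariant measures that maximise the integrals of `h 0, …, h (n - 1)` lexicographically. -/
def lexMaximizers (T : X → X) (h : ℕ → C(X, ℝ)) : ℕ → Set (ProbabilityMeasure X)
  | 0 => invMeasures T
  | n + 1 => {μ | μ ∈ lexMaximizers T h n ∧ ∀ ν ∈ lexMaximizers T h n,
      ∫ x, h n x ∂(ν : Measure X) ≤ ∫ x, h n x ∂(μ : Measure X)}

theorem lexMaximizers_isClosed_nonempty [Nonempty X] (hT : Continuous T) (h : ℕ → C(X, ℝ))
    (n : ℕ) : IsClosed (lexMaximizers T h n) ∧ (lexMaximizers T h n).Nonempty := by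
  induction n with
  | zero => exact ⟨isClosed_invMeasures hT, invMeasures_nonempty hT⟩
  | succ n ih =>
    constructor
    · have : lexMaximizers T h (n + 1) = lexMaximizers T h n ∩ ⋂ ν ∈ lexMaximizers T h n,
          {μ : ProbabilityMeasure X |
            ∫ x, h n x ∂(ν : Measure X) ≤ ∫ x, h n x ∂(μ : Measure X)} := by
        ext μ
        simp [lexMaximizers]
      rw [this]
      exact ih.1.inter (isClosed_biInter fun ν _ =>
        isClosed_le continuous_const (continuous_integral_probabilityMeasure (h n)))
    · obtain ⟨μ, hμ, hmax⟩ := ih.1.isCompact.exists_isMaxOn ih.2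
        (continuous_integral_probabilityMeasure (h n)).continuousOn
      exact ⟨μ, hμ, fun ν hν => hmax hν⟩

theorem exists_forall_mem_lexMaximizers [Nonempty X] (hT : Continuous T) (h : ℕ → C(X, ℝ)) :
    ∃ μ, ∀ n, μ ∈ lexMaximizers T h n := by
  obtain ⟨μ, hμ⟩ := IsCompact.nonempty_iInter_of_sequence_nonempty_isCompact_isClosed
    (lexMaximizers T h) (fun n μ hμ => hμ.1) (fun n => (lexMaximizers_isClosed_nonempty hT h n).2)
    (lexMaximizers_isClosed_nonempty hT h 0).1.isCompact
    (fun n => (lexMaximizers_isClosed_nonempty hT h n).1)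
  exact ⟨μ, fun n => Set.mem_iInter.1 hμ n⟩

/-- A lexicographic maximizer is an extreme point of the invariant measures. -/
theorem mem_lexMaximizers_of_convexCombination {h : ℕ → C(X, ℝ)} {μ ν₁ ν₂ : ProbabilityMeasure X}
    (hμ : ∀ n, μ ∈ lexMaximizers T h n) (h₁ : ν₁ ∈ invMeasures T) (h₂ : ν₂ ∈ invMeasures T)
    {a b : ℝ} (ha : 0 < a) (hb : 0 < b) (hab : a + b = 1)
    (hint : ∀ φ : C(X, ℝ), ∫ x, φ x ∂(μ : Measure X) =
      a * ∫ x, φ x ∂(ν₁ : Measure X) + b * ∫ x, φ x ∂(ν₂ : Measure X)) (n : ℕ) :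
    ∫ x, h n x ∂(ν₁ : Measure X) = ∫ x, h n x ∂(μ : Measure X) := by
  -- Neither integral exceeds the maximum, while their weighted mean equals it; so both are maximal.
  have key : ∀ n, ν₁ ∈ lexMaximizers T h n → ν₂ ∈ lexMaximizers T h n →
      ∫ x, h n x ∂(ν₁ : Measure X) = ∫ x, h n x ∂(μ : Measure X) ∧
        ∫ x, h n x ∂(ν₂ : Measure X) = ∫ x, h n x ∂(μ : Measure X) := by
    intro n hn₁ hn₂
    have e₁ := (hμ (n + 1)).2 ν₁ hn₁
    have e₂ := (hμ (n + 1)).2 ν₂ hn₂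
    have e := hint (h n)
    obtain rfl : b = 1 - a := by linarith
    constructor
    · refine le_antisymm e₁ (le_of_mul_le_mul_left ?_ ha)
      nlinarith
    · refine le_antisymm e₂ (le_of_mul_le_mul_left ?_ hb)
      nlinarith
  have hmem : ∀ n, ν₁ ∈ lexMaximizers T h n ∧ ν₂ ∈ lexMaximizers T h n := by
    intro n
    induction n with
    | zero => exact ⟨h₁, h₂⟩
    | succ n ih =>
      obtain ⟨e₁, e₂⟩ := key n ih.1 ih.2
      exact ⟨⟨ih.1, fun ν hν => e₁ ▸ (hμ (n + 1)).2 ν hν⟩,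
        ⟨ih.2, fun ν hν => e₂ ▸ (hμ (n + 1)).2 ν hν⟩⟩
  exact (key n (hmem n).1 (hmem n).2).1

/-- Both components of a convex decomposition of `μ` have the same `h`-integrals as `μ`. Since `h`
separates measures, `μ` is extreme, hence ergodic. -/
theorem mem_ergMeasures_of_lexMaximizers {h : ℕ → C(X, ℝ)}
    (hsep : ∀ μ ν : ProbabilityMeasure X,
      (∀ n, ∫ x, h n x ∂(μ : Measure X) = ∫ x, h n x ∂(ν : Measure X)) → μ = ν)
    {μ : ProbabilityMeasure X} (hμ : ∀ n, μ ∈ lexMaximizers T h n) : μ ∈ ergMeasures T := by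
  refine Ergodic.of_mem_extremePoints (mem_extremePoints_iff_left.2 ⟨⟨hμ 0, inferInstance⟩, ?_⟩)
  rintro ν₁ ⟨h₁, hp₁⟩ ν₂ ⟨h₂, hp₂⟩ ⟨a, b, ha, hb, hab, hμab⟩
  have ha' : a ≠ ⊤ := ne_top_of_le_ne_top ENNReal.one_ne_top (hab ▸ le_self_add)
  have hb' : b ≠ ⊤ := ne_top_of_le_ne_top ENNReal.one_ne_top (hab ▸ le_add_self)
  have := mem_lexMaximizers_of_convexCombination (ν₁ := ⟨ν₁, hp₁⟩) (ν₂ := ⟨ν₂, hp₂⟩) hμ h₁ h₂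
    (ENNReal.toReal_pos ha.ne' ha') (ENNReal.toReal_pos hb.ne' hb')
    (by rw [← ENNReal.toReal_add ha' hb', hab, ENNReal.toReal_one]) (fun φ => by
      rw [← hμab, integral_add_measure, integral_smul_measure, integral_smul_measure]
      · rfl
      · exact (φ.integrable_probabilityMeasure ⟨ν₁, hp₁⟩).smul_measure ha'
      · exact (φ.integrable_probabilityMeasure ⟨ν₂, hp₂⟩).smul_measure hb')
  exact congrArg Subtype.val (hsep ⟨ν₁, hp₁⟩ μ this)

theorem MetrizesWeakStar.eq_of_integral_eq {f : ℕ → C(X, ℝ)} (hf : MetrizesWeakStar f)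
    {μ ν : ProbabilityMeasure X}
    (h : ∀ n, ∫ x, f n x ∂(μ : Measure X) = ∫ x, f n x ∂(ν : Measure X)) : μ = ν := by
  have h0 : weakDist f μ ν = 0 := by simp [weakDist, h]
  by_contra hne
  obtain ⟨ε, hε, hsub⟩ := (hf.2 μ).mem_iff.1 (isOpen_compl_singleton.mem_nhds hne)
  exact hsub (show weakDist f μ ν < ε by rwa [h0]) rfl

/-- For every continuous `φ` and every invariant `μ` there is an ergodic measure giving `φ` at
least the integral that `μ` gives it. -/
theorem exists_ergMeasures_integral_ge [Nonempty X] (hT : Continuous T) (φ : C(X, ℝ))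
    {μ : ProbabilityMeasure X} (hμ : μ ∈ invMeasures T) :
    ∃ ν ∈ ergMeasures T, ∫ x, φ x ∂(μ : Measure X) ≤ ∫ x, φ x ∂(ν : Measure X) := by
  obtain ⟨f, hf⟩ := exists_metrizesWeakStar X
  -- Placing `φ` first makes its integral maximal among all invariant measures; the remaining `f`
  -- separates measures.
  let h : ℕ → C(X, ℝ) := fun n => Nat.casesOn n φ f
  obtain ⟨ν, hν⟩ := exists_forall_mem_lexMaximizers hT h
  exact ⟨ν, mem_ergMeasures_of_lexMaximizers
    (fun κ κ' e => hf.eq_of_integral_eq fun n => e (n + 1)) hν, (hν 1).2 μ hμ⟩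

/-- Two invariant measures disagree on some `φ`. Maximizing `φ` and `-φ` over ergodic measures can
only widen the gap. -/
theorem exists_ergMeasures_integral_lt [Nonempty X] (hT : Continuous T)
    (hU : ¬ UniquelyErgodic T) :
    ∃ μ ∈ ergMeasures T, ∃ ν ∈ ergMeasures T, ∃ φ : C(X, ℝ),
      ∫ x, φ x ∂(μ : Measure X) < ∫ x, φ x ∂(ν : Measure X) := by
  obtain ⟨κ, hκ⟩ := invMeasures_nonempty (X := X) hT
  have : ∃ κ' ∈ invMeasures T, κ' ≠ κ := by
    by_contra! hc
    exact hU ⟨κ, hκ, hc⟩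
  obtain ⟨κ', hκ', hne⟩ := this
  have : ∃ φ : C(X, ℝ), ∫ x, φ x ∂(κ : Measure X) ≠ ∫ x, φ x ∂(κ' : Measure X) := by
    by_contra! hc
    exact hne (probabilityMeasure_ext_integral hc).symm
  obtain ⟨φ, hφ⟩ := this
  have main : ∀ κ ∈ invMeasures T, ∀ κ' ∈ invMeasures T,
      ∫ x, φ x ∂(κ : Measure X) < ∫ x, φ x ∂(κ' : Measure X) →
      ∃ μ ∈ ergMeasures T, ∃ ν ∈ ergMeasures T, ∃ φ : C(X, ℝ),
        ∫ x, φ x ∂(μ : Measure X) < ∫ x, φ x ∂(ν : Measure X) := by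
    intro κ hκ κ' hκ' hlt
    obtain ⟨ν, hν, hν'⟩ := exists_ergMeasures_integral_ge hT φ hκ'
    obtain ⟨μ, hμ, hμ'⟩ := exists_ergMeasures_integral_ge hT (-φ) hκ
    simp only [ContinuousMap.neg_apply, integral_neg] at hμ'
    exact ⟨μ, hμ, ν, hν, φ, by linarith⟩
  rcases lt_or_gt_of_ne hφ with hlt | hlt
  · exact main κ hκ κ' hκ' hlt
  · exact main κ' hκ' κ hκ hlt

/-- Distinct ergodic measures are almost separated by a continuous function. -/
theorem exists_separating_continuousMap (hT : Continuous T) {μ ν : ProbabilityMeasure X}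
    (hμ : μ ∈ ergMeasures T) (hν : ν ∈ ergMeasures T) {φ : C(X, ℝ)}
    (hφ : ∫ x, φ x ∂(μ : Measure X) < ∫ x, φ x ∂(ν : Measure X)) {η : ℝ} (hη : 0 < η) :
    ∃ ψ : C(X, ℝ), (∀ x, ψ x ∈ Set.Icc (0 : ℝ) 1) ∧ ∫ x, ψ x ∂(μ : Measure X) < η ∧
      1 - η < ∫ x, ψ x ∂(ν : Measure X) := by
  set a := ∫ x, φ x ∂(μ : Measure X)
  set b := ∫ x, φ x ∂(ν : Measure X)
  -- `F` clamps the affine map sending `a` to `0` and `b` to `1`. By Birkhoff, `F` of the averages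
  -- of `φ` tends to `0` `μ`-almost surely and to `1` `ν`-almost surely.
  let F : ℝ → ℝ := fun t => max 0 (min 1 ((t - a) / (b - a)))
  have hF : Continuous F := by fun_prop
  have hF01 : ∀ t, F t ∈ Set.Icc (0 : ℝ) 1 := fun t =>
    ⟨le_max_left _ _, max_le zero_le_one (min_le_left _ _)⟩
  have hFa : F a = 0 := by simp [F]
  have hFb : F b = 1 := by simp [F, div_self (sub_pos.2 hφ).ne']
  have hA := continuous_birkhoffAverage hT φ
  let ψ : ℕ → C(X, ℝ) := fun n => ⟨fun x => F (birkhoffAverage ℝ T φ n x), hF.comp (hA n)⟩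
  have hlim : ∀ κ ∈ ergMeasures T, Tendsto (fun n => ∫ x, ψ n x ∂(κ : Measure X)) atTop
      (𝓝 (F (∫ x, φ x ∂(κ : Measure X)))) := by
    intro κ hκ
    have hc : F (∫ x, φ x ∂(κ : Measure X)) =
        ∫ _, F (∫ x, φ x ∂(κ : Measure X)) ∂(κ : Measure X) := by simp
    rw [hc]
    refine tendsto_integral_of_dominated_convergence (fun _ => 1)
      (fun n => (ψ n).continuous.aestronglyMeasurable) (integrable_const _) ?_ ?_
    · refine fun n => Eventually.of_forall fun x => ?_
      change ‖F _‖ ≤ 1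
      rw [Real.norm_of_nonneg (hF01 _).1]
      exact (hF01 _).2
    · filter_upwards [Ergodic.ae_tendsto_birkhoffAverage hκ φ.continuous.measurable
        (φ.integrable_probabilityMeasure κ)] with x hx
      exact (hF.tendsto _).comp hx
  have h1 := (hlim μ hμ).eventually_lt_const (u := η) (by change F a < η; rwa [hFa])
  have h2 := (hlim ν hν).eventually_const_lt (u := 1 - η)
    (by change 1 - η < F b; rw [hFb]; linarith)
  obtain ⟨n, hn1, hn2⟩ := (h1.and h2).exists
  exact ⟨ψ n, fun x => hF01 _, hn1, hn2⟩

end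

/-! ### Birkhoff averages along shadowing orbits. -/

section

variable {X : Type*} {T : X → X} {φ : X → ℝ} {C ω : ℝ}

theorem abs_birkhoffSum_sub_le_of_shadow (hC : ∀ x y, |φ x - φ y| ≤ C) (hω : 0 ≤ ω) {z y : X}
    {n : ℕ} {Λ : Finset ℕ} (hΛ : Λ ⊆ Finset.range n)
    (h : ∀ j ∈ Λ, |φ (T^[j] z) - φ (T^[j] y)| ≤ ω) :
    |birkhoffSum T φ n z - birkhoffSum T φ n y| ≤ n * ω + (Finset.range n \ Λ).card * C := by
  rw [birkhoffSum, birkhoffSum, ← Finset.sum_sub_distrib]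
  refine (Finset.abs_sum_le_sum_abs _ _).trans ?_
  rw [← Finset.sum_sdiff hΛ, add_comm]
  refine add_le_add ?_ ?_
  · refine (Finset.sum_le_card_nsmul _ _ ω h).trans ?_
    rw [nsmul_eq_mul]
    have := Finset.card_le_card hΛ
    rw [Finset.card_range] at this
    gcongr
  · refine (Finset.sum_le_card_nsmul _ _ C fun j _ => hC _ _).trans ?_
    rw [nsmul_eq_mul]

theorem abs_birkhoffSum_sub_mul_le (hC : ∀ x y, |φ x - φ y| ≤ C) (p : ℕ) {n : ℕ} (hn : 0 < n)
    (z y : X) : |birkhoffSum T φ p z - p * birkhoffAverage ℝ T φ n y| ≤ p * C := by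
  have hn' : (0 : ℝ) < n := by exact_mod_cast hn
  have h1 : ∀ w, |φ w - birkhoffAverage ℝ T φ n y| ≤ C := by
    intro w
    have : φ w - birkhoffAverage ℝ T φ n y =
        (n : ℝ)⁻¹ * ∑ j ∈ Finset.range n, (φ w - φ (T^[j] y)) := by
      rw [Finset.sum_sub_distrib, birkhoffAverage, birkhoffSum, Finset.sum_const,
        Finset.card_range, nsmul_eq_mul, smul_eq_mul, mul_sub, inv_mul_cancel_left₀ hn'.ne']
    rw [this, abs_mul, abs_inv, Nat.abs_cast, inv_mul_le_iff₀ hn']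
    refine (Finset.abs_sum_le_sum_abs _ _).trans ?_
    refine (Finset.sum_le_card_nsmul _ _ C fun j _ => hC _ _).trans ?_
    rw [nsmul_eq_mul, Finset.card_range]
  have h2 : birkhoffSum T φ p z - p * birkhoffAverage ℝ T φ n y =
      ∑ j ∈ Finset.range p, (φ (T^[j] z) - birkhoffAverage ℝ T φ n y) := by
    rw [Finset.sum_sub_distrib, Finset.sum_const, Finset.card_range, nsmul_eq_mul, birkhoffSum]
  rw [h2]
  refine (Finset.abs_sum_le_sum_abs _ _).trans ?_
  refine (Finset.sum_le_card_nsmul _ _ C fun j _ => h1 _).trans ?_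
  rw [nsmul_eq_mul, Finset.card_range]

/-- If the orbit of `z` follows that of `y` after time `p`, then their Birkhoff averages are
close. -/
theorem abs_birkhoffAverage_sub_le_of_shadow (hC : ∀ x y, |φ x - φ y| ≤ C) (hω : 0 ≤ ω) {z y : X}
    {p n : ℕ} (hn : 0 < n) {Λ : Finset ℕ} (hΛ : Λ ⊆ Finset.range n)
    (h : ∀ j ∈ Λ, |φ (T^[p + j] z) - φ (T^[j] y)| ≤ ω) :
    |birkhoffAverage ℝ T φ (p + n) z - birkhoffAverage ℝ T φ n y| ≤
      ω + C * (((p : ℝ) + (Finset.range n \ Λ).card) / ((p : ℝ) + n)) := by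
  have hn' : (0 : ℝ) < n := by exact_mod_cast hn
  have hpn : (0 : ℝ) < (p : ℝ) + n := by positivity
  have h1 := abs_birkhoffSum_sub_mul_le (T := T) hC p hn z y
  have h2 := abs_birkhoffSum_sub_le_of_shadow (T := T) (z := T^[p] z) (y := y) hC hω hΛ
    (fun j hj => by rw [← Function.iterate_add_apply, add_comm]; exact h j hj)
  -- Comparing the first `p` terms with the average of `y` itself, rather than discarding them,
  -- yields the sharp ratio with denominator `p + n`.
  have e1 : birkhoffAverage ℝ T φ (p + n) z - birkhoffAverage ℝ T φ n y =
      ((birkhoffSum T φ p z - p * birkhoffAverage ℝ T φ n y) +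
        (birkhoffSum T φ n (T^[p] z) - birkhoffSum T φ n y)) / ((p : ℝ) + n) := by
    simp only [birkhoffAverage, birkhoffSum_add, smul_eq_mul]
    push_cast
    field_simp
    ring
  rw [e1, abs_div, abs_of_pos hpn, div_le_iff₀ hpn]
  refine (abs_add_le _ _).trans ((add_le_add h1 h2).trans ?_)
  have e2 : (ω + C * (((p : ℝ) + (Finset.range n \ Λ).card) / ((p : ℝ) + n))) * ((p : ℝ) + n) =
      (p + n) * ω + C * (p + (Finset.range n \ Λ).card) := by
    field_simp
  rw [e2]
  have : 0 ≤ (p : ℝ) * ω := by positivity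
  nlinarith

end

/-! ### Consequences of the product property through Baire category. -/

section

variable {X : Type*} [MetricSpace X] [CompactSpace X] [MeasurableSpace X] [BorelSpace X]
  {T : X → X} {μ : ProbabilityMeasure X}

theorem ContinuousMap.exists_forall_dist_lt (φ : C(X, ℝ)) {ω : ℝ} (hω : 0 < ω) :
    ∃ δ > 0, ∀ x y, dist x y < δ → |φ x - φ y| ≤ ω := by
  obtain ⟨δ, hδ, h⟩ := Metric.uniformContinuous_iff.1
    (CompactSpace.uniformContinuous_of_continuous φ.continuous) ω hω
  exact ⟨δ, hδ, fun x y hxy => (h hxy).le⟩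

theorem ContinuousMap.abs_sub_le_two_mul_norm (φ : C(X, ℝ)) (x y : X) :
    |φ x - φ y| ≤ 2 * ‖φ‖ := by
  have h1 := φ.norm_coe_le_norm x
  have h2 := φ.norm_coe_le_norm y
  have h3 := norm_sub_le (φ x) (φ y)
  rw [← Real.norm_eq_abs]
  linarith

/-- If near every point there are points with late empirical measures near `μ`, then `μ` is a
limit measure of residually many points. -/
theorem mem_denseMeasures_of_forall_exists_empirical_mem [Nonempty X] (hT : Continuous T)
    {f : ℕ → C(X, ℝ)} (hf : MetrizesWeakStar f)
    (h : ∀ x, ∀ ε > 0, ∀ U ∈ 𝓝 μ, ∀ N : ℕ, ∃ z, dist z x < ε ∧ ∃ n ≥ N, empirical T z n ∈ U) :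
    μ ∈ denseMeasures T f := by
  -- Interiors are taken because the `weakDist` balls are only known to be neighbourhoods.
  let W : ℕ → Set (ProbabilityMeasure X) := fun k =>
    interior {ν | weakDist f μ ν < 1 / ((k : ℝ) + 1)}
  have hW : ∀ k, W k ∈ 𝓝 μ := fun k =>
    interior_mem_nhds.2 ((hf.2 μ).mem_of_mem (by positivity))
  have hres : ∀ᶠ x in residual X, ∀ i : ℕ × ℕ, ∃ n ≥ i.2, empirical T x n ∈ W i.1 := by
    refine eventually_countable_forall.2 fun i => residual_of_dense_open ?_ ?_
    · have : {x | ∃ n ≥ i.2, empirical T x n ∈ W i.1} =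
          ⋃ n, ⋃ _ : n ≥ i.2, (fun x => empirical T x n) ⁻¹' W i.1 := by
        ext x
        simp
      rw [this]
      exact isOpen_biUnion fun n _ => isOpen_interior.preimage (continuous_empirical hT n)
    · refine Metric.dense_iff.2 fun x ε hε => ?_
      obtain ⟨z, hz, hz'⟩ := h x ε hε _ (hW i.1) i.2
      exact ⟨z, hz, hz'⟩
  refine mem_denseMeasures_of_dense hT ((dense_of_mem_residual hres).mono fun x hx => ?_)
  refine ((hf.2 μ).mapClusterPt_iff_frequently).2 fun ε hε => ?_
  obtain ⟨k, hk⟩ := exists_nat_one_div_lt hε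
  refine frequently_atTop.2 fun N => ?_
  obtain ⟨n, hn, hmem⟩ := hx (k, N)
  have hlt : empirical T x n ∈ {ν | weakDist f μ ν < 1 / ((k : ℝ) + 1)} := interior_subset hmem
  exact ⟨n, hn, lt_trans hlt hk⟩

/-- The ratio `(p + c) / (p + n)` increases in `c`, and in `p` as long as `c ≤ n`. Hence the bounds
`m` and `g` may replace the actual delay and error count; this is where `g ≤ n` enters. -/
theorem MGProduct.exists_shadow {m g : ℝ → X → X → ℕ → ℕ} (h : MGProduct T m g) {x y : X} {r ε : ℝ}
    (hε : 0 < ε) (hr : ∃ᶠ n : ℕ in atTop,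
      ((m ε x y n : ℝ) + g ε x y n) / ((m ε x y n : ℝ) + n) < r) (N : ℕ) :
    ∃ (z : X) (p n : ℕ) (Λ : Finset ℕ), N ≤ n ∧ 0 < n ∧ Λ ⊆ Finset.range n ∧ dist z x < ε ∧
      ((p : ℝ) + (Finset.range n \ Λ).card) / ((p : ℝ) + n) < r ∧
      ∀ j ∈ Λ, dist (T^[p + j] z) (T^[j] y) < ε := by
  obtain ⟨M, hM1, hM⟩ := h.2 ε hε x y
  obtain ⟨n, hn, hlt⟩ := frequently_atTop.1 hr (max M N)
  have hMn : M ≤ n := (le_max_left _ _).trans hn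
  obtain ⟨z, p, Λ, hΛ, hp, hc, hz, hsh⟩ := hM n hMn
  have hn0 : 0 < n := by omega
  refine ⟨z, p, n, Λ, (le_max_right _ _).trans hn, hn0, hΛ, hz, lt_of_le_of_lt ?_ hlt, hsh⟩
  have hg := h.1 ε hε x y n hn0
  have hn' : (0 : ℝ) < n := by exact_mod_cast hn0
  have hp' : (p : ℝ) ≤ m ε x y n := by exact_mod_cast hp
  have hc' : ((Finset.range n \ Λ).card : ℝ) ≤ g ε x y n := by exact_mod_cast hc
  have hg' : (g ε x y n : ℝ) ≤ n := by exact_mod_cast hg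
  rw [div_le_div_iff₀ (by positivity) (by positivity)]
  have e1 := mul_nonneg (sub_nonneg.2 hp') (sub_nonneg.2 hg')
  have e2 := mul_nonneg (sub_nonneg.2 hc') (show (0 : ℝ) ≤ (m ε x y n : ℝ) + n by positivity)
  nlinarith

theorem MGProduct.exists_birkhoffAverage_near {m g : ℝ → X → X → ℕ → ℕ} (h : MGProduct T m g)
    {x y : X} {r c : ℝ} (hr : ∀ ε > 0, ∃ᶠ n : ℕ in atTop,
      ((m ε x y n : ℝ) + g ε x y n) / ((m ε x y n : ℝ) + n) < r)
    {φ : C(X, ℝ)} (hφ : ∀ x, φ x ∈ Set.Icc (0 : ℝ) 1)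
    (hy : Tendsto (fun n => birkhoffAverage ℝ T φ n y) atTop (𝓝 c)) {ε ω : ℝ} (hε : 0 < ε)
    (hω : 0 < ω) (N : ℕ) :
    ∃ z, dist z x < ε ∧ ∃ n ≥ N, |birkhoffAverage ℝ T φ (n + 1) z - c| < r + ω := by
  obtain ⟨δ, hδ, hδφ⟩ := φ.exists_forall_dist_lt (half_pos hω)
  obtain ⟨M, hM⟩ := eventually_atTop.1 (Metric.tendsto_nhds.1 hy (ω / 2) (half_pos hω))
  obtain ⟨z, p, n, Λ, hn, hn0, hΛ, hz, hlt, hsh⟩ :=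
    h.exists_shadow (lt_min hε hδ) (hr _ (lt_min hε hδ)) (max M (N + 1))
  -- Index `p + n - 1` is the average of length `p + n`.
  refine ⟨z, hz.trans_le (min_le_left _ _), p + n - 1, ?_, ?_⟩
  · have := (le_max_right M (N + 1)).trans hn
    omega
  · have h1 := abs_birkhoffAverage_sub_le_of_shadow (C := 1) (φ := φ)
      (fun a b => by
        have ha := hφ a
        have hb := hφ b
        rw [abs_le]
        constructor <;> linarith [ha.1, ha.2, hb.1, hb.2]) (half_pos hω).le hn0 hΛ
      (fun j hj => hδφ _ _ ((hsh j hj).trans_le (min_le_right _ _)))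
    have h2 := hM n ((le_max_left _ _).trans hn)
    rw [Real.dist_eq] at h2
    rw [show p + n - 1 + 1 = p + n by omega]
    have h3 := abs_sub_le (birkhoffAverage ℝ T φ (p + n) z) (birkhoffAverage ℝ T φ n y) c
    linarith

/-- Using `1 / (k + 1)` both as accuracy and as ratio bound gives one sequence of shadowing points
whose empirical measures converge to `μ` against every test function. -/
theorem MGProduct.ergMeasures_subset [Nonempty X] {m g : ℝ → X → X → ℕ → ℕ}
    (h : MGProduct T m g) (hT : Continuous T) {f : ℕ → C(X, ℝ)} (hf : MetrizesWeakStar f)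
    (hr : ∀ r > 0, ∀ ε > 0, ∀ x y, ∃ᶠ n : ℕ in atTop,
      ((m ε x y n : ℝ) + g ε x y n) / ((m ε x y n : ℝ) + n) < r) :
    ergMeasures T ⊆ denseMeasures T f := by
  intro μ hμ
  obtain ⟨y, hy⟩ := exists_generic_point μ hμ
  refine mem_denseMeasures_of_forall_exists_empirical_mem hT hf fun x ε hε U hU N => ?_
  have hpos : ∀ k : ℕ, (0 : ℝ) < 1 / ((k : ℝ) + 1) := fun k => by positivity
  choose z p n Λ hn hn0 hΛ hz hlt hsh using fun k : ℕ =>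
    h.exists_shadow (hpos k) (hr _ (hpos k) _ (hpos k) x y) k
  have hk : Tendsto (fun k : ℕ => 1 / ((k : ℝ) + 1)) atTop (𝓝 0) :=
    tendsto_one_div_add_atTop_nhds_zero_nat
  have hntop : Tendsto n atTop atTop := tendsto_atTop_mono hn tendsto_id
  have hlim : Tendsto (fun k => empirical T (z k) (p k + n k - 1)) atTop (𝓝 μ) := by
    refine tendsto_probabilityMeasure_iff.2 fun φ => ?_
    simp only [integral_empirical]
    have hd : Tendsto (fun k => birkhoffAverage ℝ T φ (p k + n k) (z k) -
        birkhoffAverage ℝ T φ (n k) y) atTop (𝓝 0) := by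
      rw [Metric.tendsto_nhds]
      intro η hη
      obtain ⟨δ, hδ, hδφ⟩ := φ.exists_forall_dist_lt (half_pos hη)
      have hk2 : Tendsto (fun k : ℕ => 2 * ‖φ‖ * (1 / ((k : ℝ) + 1))) atTop (𝓝 0) := by
        simpa using hk.const_mul (2 * ‖φ‖)
      filter_upwards [hk.eventually_lt_const hδ, hk2.eventually_lt_const (half_pos hη)]
        with k h1 h2
      rw [Real.dist_eq, sub_zero]
      have h3 := abs_birkhoffAverage_sub_le_of_shadow (φ := φ) φ.abs_sub_le_two_mul_norm
        (half_pos hη).le (hn0 k) (hΛ k) (fun j hj => hδφ _ _ ((hsh k j hj).trans h1))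
      have h4 := mul_le_mul_of_nonneg_left (hlt k).le (show 0 ≤ 2 * ‖φ‖ by positivity)
      linarith
    have := hd.add ((hy φ).comp hntop)
    simp only [Function.comp_def, sub_add_cancel, zero_add] at this
    refine this.congr fun k => ?_
    rw [show p k + n k - 1 + 1 = p k + n k by have := hn0 k; omega]
  obtain ⟨k, hk1, hk2, hk3⟩ := ((hlim.eventually_mem hU).and ((hk.eventually_lt_const hε).and
    (eventually_ge_atTop (N + 1)))).exists
  refine ⟨z k, (hz k).trans hk2, p k + n k - 1, ?_, hk1⟩
  have := hn k
  omega

theorem one_lt_encard_of_ergMeasures_subset [Nonempty X] (hT : Continuous T) {f : ℕ → C(X, ℝ)}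
    (hU : ¬ UniquelyErgodic T) (h : ergMeasures T ⊆ denseMeasures T f) :
    1 < (denseMeasures T f).encard := by
  obtain ⟨μ, hμ, ν, hν, φ, hφ⟩ := exists_ergMeasures_integral_lt hT hU
  refine Set.one_lt_encard_iff.2 ⟨μ, ν, h hμ, h hν, ?_⟩
  rintro rfl
  exact lt_irrefl _ hφ

theorem TopTransitive.eventually_residual_dense_orbit (hT : Continuous T)
    (h : TopTransitive T) :
    ∀ᶠ x in residual X, Dense (Set.range fun n : ℕ => T^[n] x) := by
  have hB := TopologicalSpace.isBasis_countableBasis X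
  have : ∀ᶠ x in residual X, ∀ V ∈ TopologicalSpace.countableBasis X, ∃ n : ℕ, T^[n] x ∈ V := by
    refine (eventually_countable_ball (TopologicalSpace.countable_countableBasis X)).2
      fun V hV => residual_of_dense_open ?_ ?_
    · have : {x | ∃ n : ℕ, T^[n] x ∈ V} = ⋃ n : ℕ, T^[n] ⁻¹' V := by
        ext x
        simp
      rw [this]
      exact isOpen_iUnion fun n => (hB.isOpen hV).preimage (hT.iterate n)
    · refine dense_iff_inter_open.2 fun U hU hUne => ?_
      obtain ⟨n, x, hx, hx'⟩ :=
        h U V hU (hB.isOpen hV) hUne (TopologicalSpace.nonempty_of_mem_countableBasis hV)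
      exact ⟨x, hx, n, hx'⟩
  filter_upwards [this] with x hx
  refine hB.dense_iff.2 fun V hV _ => ?_
  obtain ⟨n, hn⟩ := hx V hV
  exact ⟨_, hn, n, rfl⟩

theorem eventually_residual_frequently_birkhoffAverage_mem (hT : Continuous T) (φ : C(X, ℝ))
    {S : Set ℝ} (hS : IsOpen S)
    (h : ∀ x, ∀ ε > 0, ∀ N : ℕ, ∃ z, dist z x < ε ∧ ∃ n ≥ N, birkhoffAverage ℝ T φ (n + 1) z ∈ S) :
    ∀ᶠ x in residual X, ∃ᶠ n in atTop, birkhoffAverage ℝ T φ (n + 1) x ∈ S := by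
  simp only [frequently_atTop]
  refine eventually_countable_forall.2 fun N => residual_of_dense_open ?_ ?_
  · have : {x | ∃ n ≥ N, birkhoffAverage ℝ T φ (n + 1) x ∈ S} =
        ⋃ n, ⋃ _ : n ≥ N, (fun x => birkhoffAverage ℝ T φ (n + 1) x) ⁻¹' S := by
      ext x
      simp
    rw [this]
    exact isOpen_biUnion fun n _ => hS.preimage (continuous_birkhoffAverage hT φ _)
  · refine Metric.dense_iff.2 fun x ε hε => ?_
    obtain ⟨z, hz, hz'⟩ := h x ε hε N
    exact ⟨z, hz, hz'⟩

theorem MGTransitive.one_lt_encard [Nonempty X] {m g : ℝ → X → X → ℕ → ℕ}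
    (h : MGTransitive T m g) (hT : Continuous T) (f : ℕ → C(X, ℝ)) {κ : ℝ} (hκ : κ < 1 / 2)
    (hU : ¬ UniquelyErgodic T)
    (hr : ∀ ε > 0, ∀ x y, ∃ᶠ n : ℕ in atTop,
      ((m ε x y n : ℝ) + g ε x y n) / ((m ε x y n : ℝ) + n) < κ) :
    1 < (denseMeasures T f).encard := by
  obtain ⟨μ, hμ, ν, hν, φ, hφ⟩ := exists_ergMeasures_integral_lt hT hU
  -- This `t` gives `κ + 2 * t = 1 / 2 - 2 * t`: shadowing the generic point of `μ` keeps averages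
  -- below `1 / 2 - t`, and symmetrically for `ν`.
  obtain ⟨t, ht⟩ : ∃ t, t = (1 / 2 - κ) / 4 := ⟨_, rfl⟩
  have ht0 : 0 < t := by rw [ht]; linarith
  obtain ⟨ψ, hψ, hψμ, hψν⟩ := exists_separating_continuousMap hT hμ hν hφ ht0
  obtain ⟨y, hy⟩ := exists_generic_point μ hμ
  obtain ⟨w, hw⟩ := exists_generic_point ν hν
  have h1 := eventually_residual_frequently_birkhoffAverage_mem hT ψ
    (isOpen_Iio (a := 1 / 2 - t)) fun x ε hε N => by
      obtain ⟨z, hz, n, hn, hlt⟩ :=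
        h.1.exists_birkhoffAverage_near (fun ε hε => hr ε hε x y) hψ (hy ψ) hε ht0 N
      refine ⟨z, hz, n, hn, ?_⟩
      rw [abs_lt] at hlt
      rw [Set.mem_Iio]
      linarith
  have h2 := eventually_residual_frequently_birkhoffAverage_mem hT ψ
    (isOpen_Ioi (a := 1 / 2 + t)) fun x ε hε N => by
      obtain ⟨z, hz, n, hn, hlt⟩ :=
        h.1.exists_birkhoffAverage_near (fun ε hε => hr ε hε x w) hψ (hw ψ) hε ht0 N
      refine ⟨z, hz, n, hn, ?_⟩
      rw [abs_lt] at hlt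
      rw [Set.mem_Ioi]
      linarith
  obtain ⟨x, hx, hx1, hx2⟩ := (dense_of_mem_residual
    ((h.2.eventually_residual_dense_orbit hT).and (h1.and h2))).nonempty
  have hcont := continuous_integral_probabilityMeasure ψ
  obtain ⟨ν₁, hν₁, hν₁'⟩ := exists_mem_limitMeasures_of_frequently (T := T) (x := x)
    (isClosed_le hcont (continuous_const (y := 1 / 2 - t)))
    (hx1.mono fun n hn => by
      change ∫ y, ψ y ∂(empirical T x n : Measure X) ≤ 1 / 2 - t
      rw [integral_empirical]
      exact le_of_lt hn)
  obtain ⟨ν₂, hν₂, hν₂'⟩ := exists_mem_limitMeasures_of_frequently (T := T) (x := x)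
    (isClosed_le (continuous_const (y := 1 / 2 + t)) hcont)
    (hx2.mono fun n hn => by
      change 1 / 2 + t ≤ ∫ y, ψ y ∂(empirical T x n : Measure X)
      rw [integral_empirical]
      exact le_of_lt hn)
  have hsub := limitMeasures_subset_denseMeasures hT f hx
  refine Set.one_lt_encard_iff.2 ⟨ν₁, ν₂, hsub hν₁, hsub hν₂, ?_⟩
  rintro rfl
  rw [Set.mem_ofPred_eq] at hν₁' hν₂'
  linarith

end

/-! ### The approximate product property with full measure center. -/

section

variable {X : Type*} [MetricSpace X] [CompactSpace X] [MeasurableSpace X] [BorelSpace X]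
  {T : X → X} {μ : ProbabilityMeasure X}

/-- Every probability measure is the limit of the averages of the point masses along some
sequence of points. -/
theorem exists_seq_tendsto_average (μ : ProbabilityMeasure X) : ∃ y : ℕ → X, ∀ φ : C(X, ℝ),
    Tendsto (fun k : ℕ => (∑ i ∈ Finset.range k, φ (y i)) / (k : ℝ)) atTop
      (𝓝 (∫ x, φ x ∂(μ : Measure X))) := by
  have : Nonempty X := (μ : Measure X).nonempty_of_neZero
  let d : ℕ → C(X, ℝ) := TopologicalSpace.denseSeq C(X, ℝ)
  have hd : DenseRange d := TopologicalSpace.denseRange_denseSeq _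
  -- The sequence is an independent sample from `μ`, to which the strong law of large numbers
  -- applies.
  let P : Measure (ℕ → X) := Measure.infinitePi fun _ => (μ : Measure X)
  have hpres : ∀ i : ℕ, MeasurePreserving (Function.eval i) P (μ : Measure X) := fun i =>
    measurePreserving_eval_infinitePi (fun _ : ℕ => (μ : Measure X)) i
  have hlaw : ∀ φ : C(X, ℝ), ∀ᵐ y ∂P,
      Tendsto (fun k : ℕ => (∑ i ∈ Finset.range k, φ (y i)) / (k : ℝ)) atTop
        (𝓝 (∫ x, φ x ∂(μ : Measure X))) := by
    intro φ
    have hmap : ∀ i : ℕ, Measure.map (fun y : ℕ → X => φ (y i)) P =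
        Measure.map φ (μ : Measure X) := by
      intro i
      rw [← (hpres i).map_eq, Measure.map_map φ.continuous.measurable (measurable_pi_apply i)]
      rfl
    have hint : ∫ y, φ (y 0) ∂P = ∫ x, φ x ∂(μ : Measure X) := by
      rw [← (hpres 0).map_eq, integral_map (measurable_pi_apply 0).aemeasurable
        φ.continuous.aestronglyMeasurable]
    rw [← hint]
    refine ProbabilityTheory.strong_law_ae_real (fun i (y : ℕ → X) => φ (y i)) ?_ ?_ ?_
    · exact (hpres 0).integrable_comp_of_integrable (φ.integrable_probabilityMeasure μ)
    · intro i j hij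
      exact (ProbabilityTheory.iIndepFun_infinitePi (P := fun _ : ℕ => (μ : Measure X))
        (X := fun _ => φ) fun _ => φ.continuous.measurable).indepFun hij
    · intro i
      exact ⟨(φ.continuous.measurable.comp (measurable_pi_apply i)).aemeasurable,
        (φ.continuous.measurable.comp (measurable_pi_apply 0)).aemeasurable,
        (hmap i).trans (hmap 0).symm⟩
  obtain ⟨y, hy⟩ := (ae_all_iff.2 fun i => hlaw (d i)).exists
  refine ⟨y, fun φ => ?_⟩
  refine tendsto_of_denseRange hd
    (L := fun (k : ℕ) (φ : C(X, ℝ)) => (∑ i ∈ Finset.range k, φ (y i)) / (k : ℝ))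
    (L' := fun φ => ∫ y, φ y ∂(μ : Measure X)) (fun k φ ψ => ?_)
    (fun φ ψ => abs_integral_sub_integral_le φ ψ _) hy φ
  rcases Nat.eq_zero_or_pos k with rfl | hk
  · simp
  have hk' : (0 : ℝ) < k := by exact_mod_cast hk
  rw [← sub_div, ← Finset.sum_sub_distrib, abs_div, Nat.abs_cast, div_le_iff₀ hk']
  refine (Finset.abs_sum_le_sum_abs _ _).trans ?_
  refine (Finset.sum_le_card_nsmul _ _ ‖φ - ψ‖ fun i _ => (φ - ψ).norm_coe_le_norm (y i)).trans ?_
  rw [Finset.card_range, nsmul_eq_mul, mul_comm]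

/-- In a system whose measure center is everything, every open set contains a ball of positive
invariant measure, together with its concentric ball of twice the radius. -/
theorem exists_ball_measure_pos (hC : measureCenter T = Set.univ) {U : Set X} (hU : IsOpen U)
    (hne : U.Nonempty) : ∃ x : X, ∃ r > 0, Metric.ball x (2 * r) ⊆ U ∧
      ∃ κ ∈ invMeasures T, 0 < (κ : Measure X).real (Metric.ball x r) := by
  have hd : Dense (⋃ κ ∈ (invMeasures T : Set (ProbabilityMeasure X)),
    (κ : Measure X).support) := dense_iff_closure_eq.2 hC
  obtain ⟨x, hxU, hx⟩ := dense_iff_inter_open.1 hd U hU hne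
  simp only [Set.mem_iUnion, exists_prop] at hx
  obtain ⟨κ, hκ, hx⟩ := hx
  obtain ⟨r, hr, hsub⟩ := Metric.isOpen_iff.1 hU x hxU
  refine ⟨x, r / 2, half_pos hr, by rwa [mul_div_cancel₀ r two_ne_zero], κ, hκ, ?_⟩
  exact ENNReal.toReal_pos (Measure.mem_support_iff_forall x |>.1 hx _
    (Metric.ball_mem_nhds x (half_pos hr))).ne' (measure_ne_top _ _)

open Classical in
/-- Some orbit segment spends at least the expected amount of time in a given set. -/
theorem exists_mul_le_card_visits (hμ : μ ∈ invMeasures T) {A : Set X} (hA : MeasurableSet A)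
    (q k : ℕ) : ∃ w : X, k * (μ : Measure X).real A ≤
      ((Finset.range k).filter fun j => T^[q + j] w ∈ A).card := by
  have hint : ∀ j, Integrable (fun w => A.indicator (fun _ => (1 : ℝ)) (T^[q + j] w))
      (μ : Measure X) := fun j =>
    (MeasurePreserving.iterate hμ (q + j)).integrable_comp_of_integrable
      ((integrable_const 1).indicator hA)
  have hval : ∀ j, ∫ w, A.indicator (fun _ => (1 : ℝ)) (T^[q + j] w) ∂(μ : Measure X) =
      (μ : Measure X).real A := by
    intro j
    have h := integral_map (μ := (μ : Measure X))
      (MeasurePreserving.iterate hμ (q + j)).measurable.aemeasurable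
      (f := A.indicator fun _ => (1 : ℝ))
      ((measurable_const.indicator hA).aestronglyMeasurable)
    rw [(MeasurePreserving.iterate hμ (q + j)).map_eq, integral_indicator_const _ hA] at h
    rw [← h]
    simp
  -- By invariance the number of visits has mean `k * μ(A)`, and some point attains at least the
  -- mean.
  obtain ⟨w, hw⟩ := exists_integral_le (μ := (μ : Measure X))
    (f := fun w => ∑ j ∈ Finset.range k, A.indicator (fun _ => (1 : ℝ)) (T^[q + j] w))
    (integrable_finsetSum _ fun j _ => hint j)
  refine ⟨w, ?_⟩
  rw [integral_finsetSum _ fun j _ => hint j] at hw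
  simp only [hval, Finset.sum_const, Finset.card_range, nsmul_eq_mul] at hw
  refine hw.trans_eq ?_
  simp [Set.indicator_apply, Finset.sum_boole]

/-- If `x` missed the doubled ball throughout, each visit of `w` to the small ball would be a bad
time, and there are more visits than bad times. -/
theorem exists_visit_of_card_lt {x w c : X} {r ε : ℝ} {k q n s : ℕ} (hqk : q + k ≤ n) (hεr : ε ≤ r)
    {B : ℝ} (hB : (((Finset.range n).filter
      fun j => ε ≤ dist (T^[s + j] x) (T^[j] w)).card : ℝ) ≤ B) (P : ℕ → Prop) [DecidablePred P]
    (hP : ∀ j, P j → T^[q + j] w ∈ Metric.ball c r)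
    (hlt : B < ((Finset.range k).filter P).card) :
    ∃ j < k, T^[s + (q + j)] x ∈ Metric.ball c (2 * r) := by
  by_contra! hc
  have hsub : ((Finset.range k).filter P).image (fun j => q + j) ⊆
      (Finset.range n).filter fun j => ε ≤ dist (T^[s + j] x) (T^[j] w) := by
    intro i hi
    simp only [Finset.mem_image, Finset.mem_filter, Finset.mem_range] at hi ⊢
    obtain ⟨j, ⟨hj, hPj⟩, rfl⟩ := hi
    refine ⟨by omega, ?_⟩
    by_contra! hd
    refine hc j hj ?_
    have h1 := hP j hPj
    rw [Metric.mem_ball] at h1 ⊢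
    have h2 := dist_triangle (T^[s + (q + j)] x) (T^[q + j] w) c
    linarith
  have hcard := Finset.card_le_card hsub
  rw [Finset.card_image_of_injective _ (add_right_injective q)] at hcard
  have : (((Finset.range k).filter P).card : ℝ) ≤ _ := Nat.cast_le.2 hcard
  linarith

/-- In a system with the approximate product property and full measure center, the shadowing orbit
can be made to visit a given open set shortly before the first of the prescribed blocks. -/
theorem ApproxProduct.exists_visit (h : ApproxProduct T) (hC : measureCenter T = Set.univ)
    {U : Set X} (hU : IsOpen U) (hne : U.Nonempty) {ε δ : ℝ} (hε : 0 < ε) (hδ : 0 < δ)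
    (hδ1 : δ ≤ 1) :
    ∃ N : ℕ, 1 ≤ N ∧ ∀ n ≥ N, ∀ y : ℕ → X, ∃ (a : ℕ → ℕ) (x : X) (t : ℕ), T^[t] x ∈ U ∧ t < n ∧
      (n : ℝ) ≤ t + δ * n ∧ n ≤ a 0 ∧ (a 0 : ℝ) ≤ n * (1 + δ) ∧
      ∀ i, a i + n ≤ a (i + 1) ∧ (a (i + 1) : ℝ) - a i ≤ n * (1 + δ) ∧
        (((Finset.range n).filter
          fun j => ε ≤ dist (T^[a i + j] x) (T^[j] (y i))).card : ℝ) ≤ δ * n := by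
  classical
  obtain ⟨c, r, hr, hsub, κ, hκ, hpos⟩ := exists_ball_measure_pos hC hU hne
  set b := (κ : Measure X).real (Metric.ball c r)
  -- The first block follows a point `w` that visits the ball at least `b * k ≥ b * δ * n / 2` times
  -- in its last `k = ⌊δ * n⌋₊` steps. The error rate `b * δ / 4` cannot spoil all of them. The
  -- bound `k ≥ δ * n / 2` uses `n ≥ 2 / δ`.
  obtain ⟨N, hN1, hN⟩ := h (min ε r) (min δ (b * δ / 4)) δ (lt_min hε hr)
    (lt_min hδ (by positivity)) hδ
  obtain ⟨M, hM⟩ := exists_nat_ge (2 / δ)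
  refine ⟨max N M, hN1.trans (le_max_left _ _), fun n hn y => ?_⟩
  have hNn : N ≤ n := (le_max_left _ _).trans hn
  have hn0 : (0 : ℝ) < n := by exact_mod_cast hN1.trans hNn
  have hMn : 2 / δ ≤ n := hM.trans (by exact_mod_cast (le_max_right _ _).trans hn)
  rw [div_le_iff₀ hδ] at hMn
  set k := ⌊δ * n⌋₊ with hk
  have hk1 : (k : ℝ) ≤ δ * n := Nat.floor_le (by positivity)
  have hk2 : δ * n < k + 1 := Nat.lt_floor_add_one _
  have hkn : k ≤ n := by
    have : (k : ℝ) ≤ n := by nlinarith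
    exact_mod_cast this
  obtain ⟨w, hw⟩ := exists_mul_le_card_visits hκ (A := Metric.ball c r) measurableSet_ball
    (n - k) k
  obtain ⟨a, x, ha0, ha⟩ := hN n hNn fun i => Nat.casesOn i w y
  have hx : ∀ i, (((Finset.range n).filter fun j => ε ≤ dist (T^[a (i + 1) + j] x)
      (T^[j] (y i))).card : ℝ) ≤ δ * n := by
    intro i
    have h1 := (ha (i + 1)).2.2
    have h2 : min δ (b * δ / 4) * n ≤ δ * n := by gcongr; exact min_le_left _ _
    refine le_trans ?_ (h1.trans h2)
    norm_cast
    refine Finset.card_le_card fun j hj => ?_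
    simp only [Finset.mem_filter] at hj ⊢
    exact ⟨hj.1, (min_le_left _ _).trans hj.2⟩
  obtain ⟨j, hj, hjU⟩ := exists_visit_of_card_lt (q := n - k) (k := k) (by omega) (min_le_right ε r)
    (ha 0).2.2 _ (fun j hj => hj) (by
      refine lt_of_lt_of_le ?_ hw
      have h1 : min δ (b * δ / 4) * n ≤ b * δ / 4 * n := by gcongr; exact min_le_right _ _
      have h2 : δ * n / 2 ≤ k := by linarith
      have h3 := mul_le_mul_of_nonneg_right h2 hpos.le
      have h4 : 0 < b * δ * n := by positivity
      linarith)
  rw [ha0, zero_add] at hjU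
  have hcast : ((n - k + j : ℕ) : ℝ) = n - k + j := by
    push_cast [Nat.cast_sub hkn]
    ring
  have hj0 : (0 : ℝ) ≤ j := Nat.cast_nonneg j
  have h0 := ha 0
  rw [ha0] at h0
  refine ⟨fun i => a (i + 1), x, n - k + j, hsub hjU, by omega, by rw [hcast]; linarith,
    by simpa using h0.1, by simpa using h0.2.1, fun i => ⟨(ha (i + 1)).1, (ha (i + 1)).2.1, hx i⟩⟩

/-- After the visit to `U`, the orbit follows a point `w` that is in a small ball inside `V` more
often than the tracing fails. -/
theorem ApproxProduct.topTransitive (h : ApproxProduct T) (hC : measureCenter T = Set.univ) :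
    TopTransitive T := by
  classical
  intro U V hU hV hUne hVne
  obtain ⟨c, r, hr, hsub, κ, hκ, hpos⟩ := exists_ball_measure_pos hC hV hVne
  set b := (κ : Measure X).real (Metric.ball c r)
  have hδ : 0 < min 1 (b / 2) := lt_min one_pos (half_pos hpos)
  obtain ⟨N, hN1, hN⟩ := h.exists_visit hC hU hUne hr hδ (min_le_left _ _)
  obtain ⟨w, hw⟩ := exists_mul_le_card_visits hκ (A := Metric.ball c r) measurableSet_ball 0 N
  obtain ⟨a, x, t, htU, htN, -, ha0, -, ha⟩ := hN N le_rfl fun _ => w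
  have hN0 : (0 : ℝ) < N := by exact_mod_cast hN1
  obtain ⟨j, hj, hjV⟩ := exists_visit_of_card_lt (q := 0) (k := N) (by omega) le_rfl (ha 0).2.2 _
    (fun j hj => hj) (by
      refine lt_of_lt_of_le ?_ hw
      have h1 : min 1 (b / 2) * N ≤ b / 2 * N := by gcongr; exact min_le_right _ _
      have h2 : 0 < b * N := by positivity
      linarith)
  refine ⟨a 0 + (0 + j) - t, T^[t] x, htU, ?_⟩
  rw [Set.mem_preimage, ← Function.iterate_add_apply]
  rw [show a 0 + (0 + j) - t + t = a 0 + (0 + j) by omega]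
  exact hsub hjV

theorem ApproxProduct.exists_mgProduct_data (h : ApproxProduct T)
    (hC : measureCenter T = Set.univ) {ε δ : ℝ} (hε : 0 < ε) (hδ : 0 < δ) (x₁ x₂ : X) :
    ∃ N : ℕ, 1 ≤ N ∧ ∀ n ≥ N, ∃ (z : X) (p : ℕ) (Λ : Finset ℕ), Λ ⊆ Finset.range n ∧
      (p : ℝ) ≤ δ * n ∧ ((Finset.range n \ Λ).card : ℝ) ≤ δ * n ∧
      dist z x₁ < ε ∧ ∀ j ∈ Λ, dist (T^[p + j] z) (T^[j] x₂) < ε := by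
  classical
  obtain ⟨N, hN1, hN⟩ := h.exists_visit hC (Metric.isOpen_ball (x := x₁) (ε := ε))
    ⟨x₁, Metric.mem_ball_self hε⟩ hε (lt_min one_pos (half_pos hδ)) (min_le_left _ _)
  refine ⟨N, hN1, fun n hn => ?_⟩
  obtain ⟨a, x, t, htU, htn, ht, ha0, ha0', ha⟩ := hN n hn fun _ => x₂
  have hle : min 1 (δ / 2) * n ≤ δ / 2 * n := by gcongr; exact min_le_right _ _
  have hδn : 0 ≤ δ * n := by positivity
  -- The delay is at most `n * (1 + δ') - n * (1 - δ') = 2 * δ' * n`, where `δ' = min 1 (δ / 2)`.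
  refine ⟨T^[t] x, a 0 - t, (Finset.range n).filter fun j => dist (T^[a 0 + j] x) (T^[j] x₂) < ε,
    Finset.filter_subset _ _, ?_, ?_, htU, fun j hj => ?_⟩
  · rw [Nat.cast_sub (by omega)]
    linarith
  · have : (Finset.range n \ (Finset.range n).filter
        fun j => dist (T^[a 0 + j] x) (T^[j] x₂) < ε) = (Finset.range n).filter
        fun j => ε ≤ dist (T^[a 0 + j] x) (T^[j] x₂) := by
      ext j
      simp only [Finset.mem_sdiff, Finset.mem_filter, not_and, not_lt]
      tauto
    rw [this]
    refine (ha 0).2.2.trans ?_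
    linarith
  · rw [← Function.iterate_add_apply, show a 0 - t + j + t = a 0 + j by omega]
    exact (Finset.mem_filter.1 hj).2

theorem ApproxProduct.exists_mgTransitive (h : ApproxProduct T)
    (hC : measureCenter T = Set.univ) : ∃ m g : ℝ → X → X → ℕ → ℕ, MGTransitive T m g ∧
      ∀ ε : ℝ, 0 < ε → ∀ x y : X,
        Tendsto (fun n : ℕ => ((m ε x y n : ℝ) + g ε x y n) / (n : ℝ)) atTop (𝓝 0) := by
  let Q : ℝ → X → X → ℕ → Set ℕ := fun ε x₁ x₂ n =>
    {q | ∃ (z : X) (p : ℕ) (Λ : Finset ℕ), Λ ⊆ Finset.range n ∧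
      p ≤ q ∧ (Finset.range n \ Λ).card ≤ q ∧
      dist z x₁ < ε ∧ ∀ j ∈ Λ, dist (T^[p + j] z) (T^[j] x₂) < ε}
  have hQ : ∀ ε > 0, ∀ δ > 0, ∀ x₁ x₂ : X, ∃ N : ℕ, 1 ≤ N ∧ ∀ n ≥ N,
      ⌊δ * (n : ℝ)⌋₊ ∈ Q ε x₁ x₂ n := by
    intro ε hε δ hδ x₁ x₂
    obtain ⟨N, hN1, hN⟩ := h.exists_mgProduct_data hC hε hδ x₁ x₂
    refine ⟨N, hN1, fun n hn => ?_⟩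
    obtain ⟨z, p, Λ, hΛ, hp, hc, hz⟩ := hN n hn
    exact ⟨z, p, Λ, hΛ, Nat.le_floor hp, Nat.le_floor hc, hz⟩
  -- The least admissible bound is at most `δ * n` for large `n`, for every `δ`, so a single choice
  -- is sublinear. The default `sInf ∅ = 0` can occur only for small `n`, where nothing is required.
  refine ⟨fun ε x y n => sInf (Q ε x y n), fun ε x y n => min n (sInf (Q ε x y n)),
    ⟨⟨fun ε _ x y n _ => min_le_left _ _, fun ε hε x₁ x₂ => ?_⟩, h.topTransitive hC⟩,
    fun ε hε x y => ?_⟩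
  · obtain ⟨N, hN1, hN⟩ := hQ ε hε 1 one_pos x₁ x₂
    refine ⟨N, hN1, fun n hn => ?_⟩
    obtain ⟨z, p, Λ, hΛ, hp, hc, hz⟩ := Nat.sInf_mem ⟨_, hN n hn⟩
    refine ⟨z, p, Λ, hΛ, hp, le_min ?_ hc, hz⟩
    simpa using Finset.card_le_card (Finset.sdiff_subset (s := Finset.range n) (t := Λ))
  · rw [Metric.tendsto_nhds]
    intro η hη
    obtain ⟨N, hN1, hN⟩ := hQ ε hε (η / 3) (by positivity) x y
    filter_upwards [eventually_ge_atTop N] with n hn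
    have hn0 : (0 : ℝ) < n := by exact_mod_cast hN1.trans hn
    have h1 : ((sInf (Q ε x y n) : ℕ) : ℝ) ≤ η / 3 * n :=
      (Nat.cast_le.2 (Nat.sInf_le (hN n hn))).trans (Nat.floor_le (by positivity))
    have h2 : ((min n (sInf (Q ε x y n)) : ℕ) : ℝ) ≤ (sInf (Q ε x y n) : ℕ) :=
      Nat.cast_le.2 (min_le_right _ _)
    rw [Real.dist_eq, sub_zero, abs_of_nonneg (by positivity), div_lt_iff₀ hn0]
    have : 0 < η * n := by positivity
    linarith

theorem add_mul_le_of_forall_add_le {a : ℕ → ℕ} {n : ℕ} (h : ∀ i, a i + n ≤ a (i + 1)) (K : ℕ) :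
    a 0 + K * n ≤ a K := by
  induction K with
  | zero => simp
  | succ K ih =>
    have := h K
    have hmul : (K + 1) * n = K * n + n := by ring
    omega

open Classical in
-- Per block, the good times cost `n * ω`, the at most `δ * n` bad times `2 * C` each, and the at
-- most `δ * n` gap times `C` each.
theorem abs_birkhoffSum_sub_sum_blocks_le {ψ : X → ℝ} {C : ℝ} (hC : ∀ u, |ψ u| ≤ C) {ω : ℝ}
    (hω : 0 ≤ ω) {n : ℕ} {ε δ : ℝ} {a : ℕ → ℕ} {x : X} {y : ℕ → X}
    (ha : ∀ i, a i + n ≤ a (i + 1) ∧ (a (i + 1) : ℝ) - a i ≤ n * (1 + δ) ∧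
        (((Finset.range n).filter
          fun j => ε ≤ dist (T^[a i + j] x) (T^[j] (y i))).card : ℝ) ≤ δ * n)
    (hψ : ∀ u v, dist u v < ε → |ψ u - ψ v| ≤ ω) (K : ℕ) :
    |birkhoffSum T ψ (a K - a 0) (T^[a 0] x) - ∑ i ∈ Finset.range K, birkhoffSum T ψ n (y i)| ≤
      K * (n * (ω + 3 * C * δ)) := by
  have hC0 : 0 ≤ C := (abs_nonneg _).trans (hC x)
  induction K with
  | zero => simp
  | succ K ih =>
    have ihn := add_mul_le_of_forall_add_le (fun i => (ha i).1) K
    have ha0 : a 0 ≤ a K := (Nat.le_add_right _ _).trans ihn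
    obtain ⟨h1, h2, h3⟩ := ha K
    obtain ⟨e, he⟩ := Nat.exists_eq_add_of_le h1
    have he' : (e : ℝ) ≤ n * δ := by
      rw [he] at h2
      push_cast at h2
      linarith
    rw [show a (K + 1) - a 0 = (a K - a 0) + (n + e) by omega, birkhoffSum_add, birkhoffSum_add,
      ← Function.iterate_add_apply, show a K - a 0 + a 0 = a K by omega, Finset.sum_range_succ]
    have hblock := abs_birkhoffSum_sub_le_of_shadow (T := T) (φ := ψ) (z := T^[a K] x) (y := y K)
      (n := n) (C := 2 * C)
      (fun u v => (abs_sub _ _).trans (by linarith [hC u, hC v])) hω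
      (Finset.filter_subset (fun j => dist (T^[a K + j] x) (T^[j] (y K)) < ε) _)
      (fun j hj => by
        rw [← Function.iterate_add_apply, add_comm j]
        exact hψ _ _ (Finset.mem_filter.1 hj).2)
    have hbad : Finset.range n \ (Finset.range n).filter
        (fun j => dist (T^[a K + j] x) (T^[j] (y K)) < ε) = (Finset.range n).filter
        fun j => ε ≤ dist (T^[a K + j] x) (T^[j] (y K)) := by
      ext j
      simp only [Finset.mem_sdiff, Finset.mem_filter, not_and, not_lt]
      tauto
    rw [hbad] at hblock
    have hrest : |birkhoffSum T ψ e (T^[n] (T^[a K] x))| ≤ e * C := by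
      refine (Finset.abs_sum_le_sum_abs _ _).trans ?_
      refine (Finset.sum_le_card_nsmul _ _ C fun j _ => hC _).trans ?_
      rw [Finset.card_range, nsmul_eq_mul]
    have h4 := mul_le_mul_of_nonneg_right h3 (show 0 ≤ 2 * C by positivity)
    have h5 := mul_le_mul_of_nonneg_right he' hC0
    push_cast
    rw [abs_le] at *
    constructor <;> nlinarith

open Classical in
/-- The orbit of a point that follows blocks sampled from `μ` has a limit measure near `μ`. -/
theorem exists_mem_limitMeasures_of_blocks (hT : Continuous T) (hμ : μ ∈ invMeasures T)
    {y : ℕ → X} (hy : ∀ φ : C(X, ℝ),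
      Tendsto (fun k : ℕ => (∑ i ∈ Finset.range k, φ (y i)) / (k : ℝ)) atTop
        (𝓝 (∫ x, φ x ∂(μ : Measure X))))
    {n : ℕ} (hn : 0 < n) {ε δ : ℝ} {a : ℕ → ℕ} {x : X}
    (ha : ∀ i, a i + n ≤ a (i + 1) ∧ (a (i + 1) : ℝ) - a i ≤ n * (1 + δ) ∧
        (((Finset.range n).filter
          fun j => ε ≤ dist (T^[a i + j] x) (T^[j] (y i))).card : ℝ) ≤ δ * n) :
    ∃ ν ∈ limitMeasures T x, ∀ φ : C(X, ℝ), ∀ ω > 0,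
      (∀ u v, dist u v < ε → |φ u - φ v| ≤ ω) →
      |∫ x, φ x ∂(ν : Measure X) - ∫ x, φ x ∂(μ : Measure X)| ≤ 2 * ω + 6 * ‖φ‖ * δ := by
  have hn' : (1 : ℝ) ≤ n := by exact_mod_cast hn
  have hδ : 0 ≤ δ := by
    have := (Nat.cast_nonneg _).trans (ha 0).2.2
    exact nonneg_of_mul_nonneg_left this (by linarith)
  have hgrow := add_mul_le_of_forall_add_le fun i => (ha i).1
  have hpos : ∀ K, K < a (K + 1) - a 0 := by
    intro K
    have h1 := hgrow (K + 1)
    have h2 : K + 1 ≤ (K + 1) * n := Nat.le_mul_of_pos_right _ hn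
    omega
  -- Averages are cut at block starts; the `- 1` is the index shift of `empirical`.
  let s : ℕ → ℕ := fun K => a (K + 1) - a 0 - 1
  have hs : Tendsto s atTop atTop :=
    tendsto_atTop_mono (fun K => Nat.le_sub_one_of_lt (hpos K)) tendsto_id
  have hs1 : ∀ K, s K + 1 = a (K + 1) - a 0 := fun K => Nat.sub_add_cancel (by
    have := hpos K
    omega)
  obtain ⟨ν, hν⟩ := exists_clusterPt_of_compactSpace
    (map (empirical T (T^[a 0] x) ∘ s) atTop)
  have hν' : MapClusterPt ν atTop (empirical T (T^[a 0] x) ∘ s) := hν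
  refine ⟨ν, ?_, fun φ ω hω hφ => ?_⟩
  · rw [← limitMeasures_iterate T x (a 0)]
    exact MapClusterPt.of_comp hs hν'
  set I := ∫ x, φ x ∂(μ : Measure X) with hI
  refine IsClosed.mem_of_mapClusterPt (s := {κ : ProbabilityMeasure X |
    |∫ x, φ x ∂(κ : Measure X) - I| ≤ 2 * ω + 6 * ‖φ‖ * δ}) ?_ hν' ?_
  · exact isClosed_le ((continuous_integral_probabilityMeasure φ).sub continuous_const).abs
      continuous_const
  -- Once centred, the block sum `Ψ` has integral zero by invariance, so its sum over the first `K`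
  -- sampled blocks is `o(K)`. Tracing contributes `ω + 6 * ‖φ‖ * δ` and sampling a further `ω`.
  let ψ : C(X, ℝ) := φ - ContinuousMap.const X I
  have hψ : ∀ u, |ψ u| ≤ 2 * ‖φ‖ := by
    intro u
    have h1 := φ.norm_coe_le_norm u
    have h2 := abs_integral_sub_integral_le φ 0 μ
    simp only [ContinuousMap.zero_apply, integral_zero, sub_zero] at h2
    have h3 := abs_sub (φ u) I
    rw [Real.norm_eq_abs] at h1
    change |φ u - I| ≤ _
    linarith
  let Ψ : C(X, ℝ) := ⟨birkhoffSum T ψ n,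
    continuous_finsetSum _ fun i _ => ψ.continuous.comp (hT.iterate i)⟩
  have hΨ : ∫ u, Ψ u ∂(μ : Measure X) = 0 := by
    change ∫ u, ∑ i ∈ Finset.range n, ψ (T^[i] u) ∂(μ : Measure X) = 0
    rw [integral_finsetSum (f := fun i u => ψ (T^[i] u)) _ fun i _ =>
      (MeasurePreserving.iterate hμ i).integrable_comp_of_integrable
        (ψ.integrable_probabilityMeasure μ)]
    refine Finset.sum_eq_zero fun i _ => ?_
    have h := integral_map (μ := (μ : Measure X))
      (MeasurePreserving.iterate hμ i).measurable.aemeasurable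
      (f := ψ) ψ.continuous.aestronglyMeasurable
    rw [(MeasurePreserving.iterate hμ i).map_eq] at h
    rw [← h]
    change ∫ u, (φ u - I) ∂(μ : Measure X) = 0
    rw [integral_sub (φ.integrable_probabilityMeasure μ) (integrable_const I)]
    simp [hI]
  have hΨy := hy Ψ
  rw [hΨ] at hΨy
  filter_upwards [((tendsto_add_atTop_iff_nat 1).2 hΨy).eventually
    (Metric.ball_mem_nhds (0 : ℝ) hω)] with K hK
  rw [Real.dist_eq, sub_zero, abs_div, Nat.abs_cast,
    div_lt_iff₀ (by positivity)] at hK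
  have hb := abs_birkhoffSum_sub_sum_blocks_le (T := T) (ψ := ψ) hψ hω.le ha
    (fun u v huv => by
      change |φ u - I - (φ v - I)| ≤ ω
      rw [sub_sub_sub_cancel_right]
      exact hφ u v huv) (K + 1)
  have hL : ((K + 1 : ℕ) : ℝ) * n ≤ ((a (K + 1) - a 0 : ℕ) : ℝ) := by
    exact_mod_cast (show (K + 1) * n ≤ a (K + 1) - a 0 by
      have := hgrow (K + 1)
      omega)
  have hL0 : (0 : ℝ) < ((a (K + 1) - a 0 : ℕ) : ℝ) := by
    exact_mod_cast (Nat.zero_le _).trans_lt (hpos K)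
  change |∫ u, φ u ∂(empirical T (T^[a 0] x) (s K) : Measure X) - I| ≤ _
  rw [integral_empirical, hs1]
  have he : birkhoffAverage ℝ T φ (a (K + 1) - a 0) (T^[a 0] x) - I =
      birkhoffSum T ψ (a (K + 1) - a 0) (T^[a 0] x) / ((a (K + 1) - a 0 : ℕ) : ℝ) := by
    have : birkhoffSum T ψ (a (K + 1) - a 0) (T^[a 0] x) =
        birkhoffSum T φ (a (K + 1) - a 0) (T^[a 0] x) - ((a (K + 1) - a 0 : ℕ) : ℝ) * I := by
      simp [birkhoffSum, ψ, Finset.sum_sub_distrib]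
    rw [this, birkhoffAverage, smul_eq_mul]
    field_simp
  rw [he, abs_div, Nat.abs_cast, div_le_iff₀ hL0]
  have h1 : |birkhoffSum T ψ (a (K + 1) - a 0) (T^[a 0] x)| ≤
      ((K + 1 : ℕ) : ℝ) * (n * (ω + 3 * (2 * ‖φ‖) * δ)) + ω * ((K + 1 : ℕ) : ℝ) := by
    have h2 := abs_sub_abs_le_abs_sub (birkhoffSum T ψ (a (K + 1) - a 0) (T^[a 0] x))
      (∑ i ∈ Finset.range (K + 1), birkhoffSum T ψ n (y i))
    have h3 : |∑ i ∈ Finset.range (K + 1), birkhoffSum T ψ n (y i)| < ω * ((K + 1 : ℕ) : ℝ) := hK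
    linarith
  refine h1.trans ?_
  have h4 : ω * ((K + 1 : ℕ) : ℝ) ≤ ω * (((K + 1 : ℕ) : ℝ) * n) :=
    mul_le_mul_of_nonneg_left (le_mul_of_one_le_right (Nat.cast_nonneg _) hn') hω.le
  have h5 := mul_le_mul_of_nonneg_left hL (show 0 ≤ 2 * ω + 6 * ‖φ‖ * δ by positivity)
  linarith

/-- For each accuracy `1 / (k + 1)`, an orbit meeting `U` and then following the sampled blocks has
a limit measure `ν k`; these converge to `μ`. The limit measures only approximate `μ`, which is all
that `nearSaturated` asks. -/
theorem ApproxProduct.invMeasures_subset [Nonempty X] (h : ApproxProduct T) (hT : Continuous T)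
    (hC : measureCenter T = Set.univ) {f : ℕ → C(X, ℝ)} (hf : MetrizesWeakStar f) :
    invMeasures T ⊆ denseMeasures T f := by
  classical
  intro μ hμ
  refine ⟨hμ, fun ε hε => dense_iff_inter_open.2 fun U hU hne => ?_⟩
  obtain ⟨y, hy⟩ := exists_seq_tendsto_average μ
  have key : ∀ k : ℕ, ∃ z ∈ U, ∃ ν ∈ limitMeasures T z, ∀ φ : C(X, ℝ), ∀ ω > 0,
      (∀ u v, dist u v < 1 / ((k : ℝ) + 1) → |φ u - φ v| ≤ ω) →
      |∫ x, φ x ∂(ν : Measure X) - ∫ x, φ x ∂(μ : Measure X)| ≤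
        2 * ω + 6 * ‖φ‖ * (1 / ((k : ℝ) + 1)) := by
    intro k
    have hk : (0 : ℝ) < 1 / ((k : ℝ) + 1) := by positivity
    obtain ⟨N, hN1, hN⟩ := h.exists_visit hC hU hne hk hk
      (by rw [div_le_one (by positivity)]; linarith [(Nat.cast_nonneg k : (0 : ℝ) ≤ k)])
    obtain ⟨a, x, t, htU, -, -, -, -, ha⟩ := hN N le_rfl y
    obtain ⟨ν, hν, hν'⟩ := exists_mem_limitMeasures_of_blocks hT hμ hy hN1 ha
    exact ⟨_, htU, ν, by rwa [limitMeasures_iterate], hν'⟩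
  choose z hzU ν hν hνφ using key
  have hlim : Tendsto ν atTop (𝓝 μ) := by
    refine tendsto_probabilityMeasure_iff.2 fun φ => ?_
    rw [Metric.tendsto_nhds]
    intro η hη
    obtain ⟨δ, hδ, hδφ⟩ := φ.exists_forall_dist_lt (show 0 < η / 4 by positivity)
    have hk : Tendsto (fun k : ℕ => 1 / ((k : ℝ) + 1)) atTop (𝓝 0) :=
      tendsto_one_div_add_atTop_nhds_zero_nat
    have hk2 : Tendsto (fun k : ℕ => 6 * ‖φ‖ * (1 / ((k : ℝ) + 1))) atTop (𝓝 0) := by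
      simpa using hk.const_mul (6 * ‖φ‖)
    filter_upwards [hk.eventually_lt_const hδ, hk2.eventually_lt_const (half_pos hη)]
      with k h1 h2
    have := hνφ k φ (η / 4) (by positivity) fun u v huv => hδφ u v (huv.trans h1)
    rw [Real.dist_eq]
    linarith
  obtain ⟨k, hk⟩ := (hlim.eventually_mem ((hf.2 μ).mem_of_mem hε)).exists
  exact ⟨z k, hzU k, mem_nearSaturated (hν k) (le_of_lt hk)⟩

end

/-! ### Minimal systems. -/

section

variable {X : Type*} [MetricSpace X] [CompactSpace X] [MeasurableSpace X] [BorelSpace X]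
  {T : X → X}

theorem MinimalSystem.surjective (h : MinimalSystem T) (hT : Continuous T) :
    Function.Surjective T := by
  intro x
  have hcl : IsClosed (Set.range T) := (isCompact_range hT).isClosed
  have hd : Dense (Set.range T) := (h (T x)).mono (by
    rintro _ ⟨n, rfl⟩
    exact ⟨T^[n] x, (Function.Commute.iterate_self T n |>.eq x).symm⟩)
  have := hd x
  rwa [hcl.closure_eq] at this

theorem MinimalSystem.topTransitive (h : MinimalSystem T) : TopTransitive T := by
  rintro U V - hV ⟨x, hx⟩ hVne
  obtain ⟨_, hz, n, rfl⟩ := dense_iff_inter_open.1 (h x) V hV hVne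
  exact ⟨n, x, hx, hz⟩

/-- Uniform recurrence: in a minimal system the orbit segments of some bounded length are
`ε`-dense. -/
theorem MinimalSystem.exists_forall_exists_dist_lt (h : MinimalSystem T) (hT : Continuous T)
    {ε : ℝ} (hε : 0 < ε) : ∃ M : ℕ, ∀ y x : X, ∃ l ≤ M, dist (T^[l] y) x < ε := by
  -- Compactness of the product makes the bound uniform in both points.
  obtain ⟨t, ht⟩ := (isCompact_univ (X := X × X)).elim_finite_subcover
    (fun l : ℕ => {q : X × X | dist (T^[l] q.1) q.2 < ε})
    (fun l => isOpen_lt (((hT.iterate l).comp continuous_fst).dist continuous_snd)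
      continuous_const) (fun q _ => by
        obtain ⟨_, hz, n, rfl⟩ := Metric.dense_iff.1 (h q.1) q.2 ε hε
        exact Set.mem_iUnion.2 ⟨n, hz⟩)
  refine ⟨t.sup id, fun y x => ?_⟩
  obtain ⟨l, hl, hlt⟩ := Set.mem_iUnion₂.1 (ht (Set.mem_univ (y, x)))
  exact ⟨l, Finset.le_sup (f := id) hl, hlt⟩

/-- Pull `x₂` back `M` steps to `w`. The segment `w, …, T^[M] w` passes near `x₁` at some time `l`,
and from there reaches `x₂` exactly in `M - l` steps. -/
theorem MinimalSystem.exists_iterate_eq (h : MinimalSystem T) (hT : Continuous T) {ε : ℝ}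
    (hε : 0 < ε) : ∃ M : ℕ, ∀ x₁ x₂ : X, ∃ l ≤ M, ∃ z, dist z x₁ < ε ∧ T^[l] z = x₂ := by
  obtain ⟨M, hM⟩ := h.exists_forall_exists_dist_lt hT hε
  refine ⟨M, fun x₁ x₂ => ?_⟩
  obtain ⟨w, rfl⟩ := (h.surjective hT).iterate M x₂
  obtain ⟨l, hl, hlt⟩ := hM w x₁
  exact ⟨M - l, Nat.sub_le _ _, T^[l] w, hlt, by
    rw [← Function.iterate_add_apply, Nat.sub_add_cancel hl]⟩

theorem MinimalSystem.ergMeasures_subset [Nonempty X] (h : MinimalSystem T) (hT : Continuous T)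
    (f : ℕ → C(X, ℝ)) : ergMeasures T ⊆ denseMeasures T f := by
  intro μ hμ
  obtain ⟨y, hy⟩ := exists_generic_point μ hμ
  refine limitMeasures_subset_denseMeasures hT f (h y) (Tendsto.mapClusterPt ?_)
  refine tendsto_probabilityMeasure_iff.2 fun φ => ?_
  simp only [integral_empirical]
  exact (tendsto_add_atTop_iff_nat 1).2 (hy φ)

end

/-- Lower limits are taken in `EReal`, where unboundedness leads to no default value; `encard` also
counts infinite sets correctly. -/
theorem theoremD {X : Type*} [MetricSpace X] [CompactSpace X] [Nonempty X]
    [MeasurableSpace X] [BorelSpace X] (T : X → X) (hT : Continuous T)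
    (f : ℕ → C(X, ℝ)) (hf : MetrizesWeakStar f) :
    (∀ (κ : ℝ) (m g : ℝ → X → X → ℕ → ℕ), 0 < κ → κ < 1 / 2 →
      ¬ UniquelyErgodic T → MGTransitive T m g →
      (∀ ε : ℝ, 0 < ε → ∀ x y : X,
        liminf (fun n : ℕ =>
          ((((m ε x y n : ℝ) + g ε x y n) / ((m ε x y n : ℝ) + n) : ℝ) : EReal)) atTop
            < (κ : EReal)) →
      1 < (denseMeasures T f).encard) ∧
    (∀ m g : ℝ → X → X → ℕ → ℕ, MGProduct T m g →
      (∀ ε : ℝ, 0 < ε → ∀ x y : X,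
        liminf (fun n : ℕ => ((((m ε x y n : ℝ) + g ε x y n) / (n : ℝ) : ℝ) : EReal)) atTop
          = 0) →
      ergMeasures T ⊆ denseMeasures T f ∧
        (¬ UniquelyErgodic T → 1 < (denseMeasures T f).encard)) ∧
    (ApproxProduct T → measureCenter T = Set.univ →
      denseMeasures T f = invMeasures T ∧
        ∃ m g : ℝ → X → X → ℕ → ℕ, MGTransitive T m g ∧
          ∀ ε : ℝ, 0 < ε → ∀ x y : X,
            Tendsto (fun n : ℕ => ((m ε x y n : ℝ) + g ε x y n) / (n : ℝ)) atTop (𝓝 0)) ∧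
    (MinimalSystem T →
      ergMeasures T ⊆ denseMeasures T f ∧
        ∃ m : ℝ → ℕ,
          (∀ ε : ℝ, 0 < ε → ∀ x₁ x₂ : X, ∀ n : ℕ, 1 ≤ n → ∀ ε' : ℝ, 0 < ε' →
            ∃ (l : ℕ) (z : X), l ≤ m ε ∧ dist z x₁ < ε ∧
              ∀ j : ℕ, j < n → dist (T^[l + j] z) (T^[j] x₂) < ε') ∧
          MGTransitive T (fun ε _ _ _ => m ε) (fun _ _ _ _ => 0) ∧
          ∀ ε : ℝ, 0 < ε → Tendsto (fun n : ℕ => (m ε : ℝ) / (n : ℝ)) atTop (𝓝 0)) := by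
  refine ⟨?_, ?_, ?_, ?_⟩
  · intro κ m g _ hκ hU hMG hlim
    refine hMG.one_lt_encard hT f hκ hU fun ε hε x y => ?_
    exact (frequently_lt_of_liminf_lt (h := hlim ε hε x y)).mono fun n hn =>
      EReal.coe_lt_coe_iff.1 hn
  · intro m g hMG hlim
    have hsub : ergMeasures T ⊆ denseMeasures T f := by
      refine hMG.ergMeasures_subset hT hf fun r hr ε hε x y => ?_
      have hlt : liminf (fun n : ℕ =>
          ((((m ε x y n : ℝ) + g ε x y n) / (n : ℝ) : ℝ) : EReal)) atTop < (r : EReal) := by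
        rw [hlim ε hε x y]
        exact_mod_cast hr
      refine ((frequently_lt_of_liminf_lt (h := hlt)).and_eventually
        (eventually_gt_atTop 0)).mono fun n hn => lt_of_le_of_lt ?_ (EReal.coe_lt_coe_iff.1 hn.1)
      have hn0 : (0 : ℝ) < n := by exact_mod_cast hn.2
      -- Dropping `m` from the denominator only enlarges the ratio.
      gcongr
      exact le_add_of_nonneg_left (Nat.cast_nonneg _)
    exact ⟨hsub, fun hU => one_lt_encard_of_ergMeasures_subset hT hU hsub⟩
  · intro h hC
    exact ⟨Set.Subset.antisymm (fun μ hμ => hμ.1) (h.invMeasures_subset hT hC hf),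
      h.exists_mgTransitive hC⟩
  · intro h
    refine ⟨h.ergMeasures_subset hT f, ?_⟩
    choose! m hm using fun (ε : ℝ) (hε : 0 < ε) => h.exists_iterate_eq hT hε
    have key : ∀ ε : ℝ, 0 < ε → ∀ x₁ x₂ : X, ∀ n : ℕ, 1 ≤ n → ∀ ε' : ℝ, 0 < ε' →
        ∃ (l : ℕ) (z : X), l ≤ m ε ∧ dist z x₁ < ε ∧
          ∀ j : ℕ, j < n → dist (T^[l + j] z) (T^[j] x₂) < ε' := by
      intro ε hε x₁ x₂ n _ ε' hε'
      obtain ⟨l, hl, z, hz, hlz⟩ := hm ε hε x₁ x₂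
      refine ⟨l, z, hl, hz, fun j _ => ?_⟩
      rw [add_comm, Function.iterate_add_apply, hlz, dist_self]
      exact hε'
    refine ⟨m, key, ⟨⟨fun _ _ _ _ _ _ => Nat.zero_le _, fun ε hε x₁ x₂ =>
      ⟨1, le_rfl, fun n hn => ?_⟩⟩, h.topTransitive⟩, fun ε _ => ?_⟩
    · obtain ⟨l, z, hl, hz, hsh⟩ := key ε hε x₁ x₂ n hn ε hε
      exact ⟨z, l, Finset.range n, subset_rfl, hl, by simp, hz,
        fun j hj => hsh j (Finset.mem_range.1 hj)⟩
    · exact tendsto_const_nhds.div_atTop tendsto_natCast_atTop_atTop
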